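/- **Setting.** There are $n\ge 1$ agents. Agent $i$ has a finite state space $\mathcal S_i$; the finite action space $\mathcal A$ is common to all agents. Agent $i$ has a transition kernel $P_i$, an initial distribution $\rho_i$ and rewards $r_i(s,a,s')\in[-1,1]$; the horizon $H\ge 1$ and the discount factor $\gamma\in[0,1)$ are common. Policies $\pi_\theta(a|s)>0$ are parameterized by $\theta\in\mathbb R^d$. For a trajectory $\tau=(s^0,a^0,\dots,s^{H-1},a^{H-1},s^H)$ put $p_i(\tau|\theta)=\rho_i(s^0)\prod_{h<H}\pi_\theta(a^h|s^h)P_i(s^{h+1}|s^h,a^h)$, $R_i(\tau)=\sum_{h<H}\gamma^h r_i(s^h,a^h,s^{h+1})$, $V_i(\theta)=\mathbb E_{\tau\sim p_i(\cdot|\theta)}R_i(\tau)$ and $V=\frac1n\sum_i V_i$. With fixed baselines $b_i\in\mathbb R$ let $|b|=\max_i|b_i|$ and $$g_i(\tau|\theta)=\Big(\sum_{h<H}\nabla\log\pi_\theta(a^h|s^h)\Big)(R_i(\tau)-b_i),\qquad \omega(\tau|\tilde\theta,\theta)=\prod_{h<H}\frac{\pi_{\tilde\theta}(a^h|s^h)}{\pi_\theta(a^h|s^h)},$$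 $$F_i(\theta)=\mathbb E_{\tau\sim p_i(\cdot|\theta)}\Big[\tfrac1H\sum_{h<H}\nabla\log\pi_\theta(a^h|s^h)\,\nabla\log\pi_\theta(a^h|s^h)^{\mathsf T}\Big].$$ **Algorithm (MDNPG).** The agents communicate over an undirected graph; $\mathcal N(i)$ is the set of neighbours of $i$ together with $i$, and $W\in\mathbb R^{n\times n}$ is a weight matrix with $W_{ij}=0$ for $j\notin\mathcal N(i)$. Inputs: $T,B\ge 1$, $\eta$, $\beta$ and a common initial parameter $\theta^0$. Set $\theta_i^0=\theta^0$, $v_i^0=\frac1B\sum_{b=1}^B g_i(\tau_{i,b}^0|\theta^0)$ with independent $\tau_{i,b}^0\sim p_i(\cdot|\theta^0)$, and $y_i^1=\sum_{j\in\mathcal N(i)}W_{ij}v_j^0$. For $t\ge 1$ draw, given the past, independent $\tau_i^t\sim p_i(\cdot|\theta_i^t)$ and set $$v_i^t=\beta g_i(\tau_i^t|\theta_i^t)+(1-\beta)\big(v_i^{t-1}+g_i(\tau_i^t|\theta_i^t)-\omega(\tau_i^t|\theta_i^{t-1},\theta_i^t)\,g_i(\tau_i^t|\theta_i^{t-1})\big),$$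 $$y_i^{t+1}=\sum_{j\in\mathcal N(i)}W_{ij}(y_j^t+v_j^t-v_j^{t-1});$$ and for every $t\ge 0$ $$\theta_i^{t+1}=\sum_{j\in\mathcal N(i)}W_{ij}\big(\theta_j^t+\eta F_j(\theta_j^t)^{-1}y_j^{t+1}\big).$$ The output $\theta_{\rm out}$ is $\theta_i^t$ with $(i,t)$ uniform on $\{1,\dots,n\}\times\{0,\dots,T\}$, independent of the run. **Theorem 1.** Assume: 1. $W\mathbf 1=\mathbf 1$ and $\mathbf 1^{\mathsf T}W=\mathbf 1^{\mathsf T}$; let $\rho=\|W-\frac1n\mathbf 1\mathbf 1^{\mathsf T}\|_2$. 2. $V^\star=\sup_\theta V(\theta)<\infty$; let $\Delta=V^\star-V(\theta^0)$. 3. $\theta\mapsto\log\pi_\theta(a|s)$ is twice differentiable, with $\|\nabla\log\pi_\theta(a|s)\|^2\le G$ and $\|\nabla^2\log\pi_\theta(a|s)\|\le M$ for all $\theta,a,s$. 4. $\mathrm{Var}_{\tau\sim p_i(\cdot|\theta)}(\omega(\tau|\tilde\theta,\theta))\le W_{\rm v}$ for all $i,\theta,\tilde\theta$, with a constant $W_{\rm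 v}$. 5. $\mathbb E_{\tau\sim p_i(\cdot|\theta)}\|g_i(\tau|\theta)-\nabla V_i(\theta)\|^2\le\nu_i^2$ for all $i,\theta$; let $\bar\nu^2=\frac1n\sum_i\nu_i^2$. 6. $F_i(\theta)\succeq\mu_F I_d$ for all $i,\theta$, with a constant $\mu_F>0$; let $\kappa_F=G/\mu_F$. Let $L=\frac{H(M+HG)}{1-\gamma}$, $L_g=\frac{HM(1+|b|)}{1-\gamma}$, $C_g=\frac{HG^{1/2}(1+|b|)}{1-\gamma}$, $C_\omega^2=H(2HG+M)(W_{\rm v}+1)$ and $\Phi^2=L_g^2+C_g^2C_\omega^2$. If $$0<\eta<\frac{\mu_F(1-\rho^2)^3}{\kappa_F\sqrt{1632000(L^2+\Phi^2)}}\quad\text{and}\quad \frac{1632000(L^2+\Phi^2)\kappa_F^2\eta^2}{n\mu_F^2(1-\rho^2)^6}\le\beta<\frac1n,$$ then $$\mathbb E\|\nabla V(\theta_{\rm out})\|^2\le\frac{8G^2\Delta}{T\eta\mu_F}+\frac{76\bar\nu^2\kappa_F^2}{nT\beta B}+\frac{152\beta\bar\nu^2\kappa_F^2}{n}+\frac{44\rho^2\bar\nu^2\kappa_F^2}{TB(1-\rho^2)}+\frac{352\beta^2\bar\nu^2\kappa_F^2}{(1-\rho^2)^2}$$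 $$\qquad+\frac{352\beta\bar\nu^2\kappa_F^2}{TB(1-\rho^2)^2}+\frac{704\bar\nu^2\kappa_F^2\beta^3}{(1-\rho^2)^2}+\frac{44\rho^2\kappa_F^2}{nT(1-\rho^2)}\sum_{i=1}^n\|\nabla V_i(\theta^0)\|^2.$$ -/

import Mathlib

open scoped BigOperators

noncomputable section

namespace MDNPG

universe u v

/-- The parameter space `ℝ^d` with the Euclidean norm. -/
abbrev Param (d : ℕ) := EuclideanSpace ℝ (Fin d)

/-- A trajectory `(s^0, a^0, s^1, a^1, …, s^{H-1}, a^{H-1}, s^H)`: its states and its actions. The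
rewards are functions of these. -/
abbrev Traj (H : ℕ) (S : Type u) (A : Type v) := (Fin (H + 1) → S) × (Fin H → A)

/-- An `n`-agent collaborative reinforcement learning problem with a policy parameterized by
`θ ∈ ℝ^d`. Agent `i` has the finite state space `S i`; the finite action space `A` is common.
* Collaborative RL: all `S i`, `trans i` and `policy θ i` coincide, and `A` is the joint action
  space.
* Multi-task RL: `S i` and `trans i` depend on the agent, and `policy θ i` is the shared policy
  evaluated at the states of agent `i`. -/
structure Model (n d : ℕ) (S : Fin n → Type u) (A : Type v) [∀ i, Fintype (S i)] [Fintype A] where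
  /-- the horizon -/
  H : ℕ
  H_pos : 0 < H
  /-- the discount factor -/
  γ : ℝ
  γ_nonneg : 0 ≤ γ
  γ_lt_one : γ < 1
  /-- the distribution of the initial state -/
  init : ∀ i, S i → ℝ
  init_mem : ∀ i, init i ∈ stdSimplex ℝ (S i)
  /-- `trans i s a s'` is the probability that agent `i` moves from `(s, a)` to `s'` -/
  trans : ∀ i, S i → A → S i → ℝ
  trans_mem : ∀ i s a, trans i s a ∈ stdSimplex ℝ (S i)
  /-- `reward i s a s'` is the reward of agent `i` for the transition from `(s, a)` to `s'` -/
  reward : ∀ i, S i → A → S i → ℝ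
  reward_mem : ∀ i s a s', reward i s a s' ∈ Set.Icc (-1 : ℝ) 1
  /-- `policy θ i s a` is the probability `π_θ(a | s)` -/
  policy : Param d → ∀ i, S i → A → ℝ
  policy_mem : ∀ θ i s, policy θ i s ∈ stdSimplex ℝ A
  /-- the baseline of the gradient estimator of each agent -/
  baseline : Fin n → ℝ

namespace Model

variable {n d : ℕ} {S : Fin n → Type u} {A : Type v} [∀ i, Fintype (S i)] [Fintype A]
  (𝓜 : Model n d S A)

/-- Trajectories of agent `i`. -/
abbrev AgentTraj (i : Fin n) := Traj 𝓜.H (S i) A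

/-- The log-policy `θ ↦ log π_θ(a | s)`. -/
def logPolicy (i : Fin n) (s : S i) (a : A) (θ : Param d) : ℝ := Real.log (𝓜.policy θ i s a)

/-- The score `∇_θ log π_θ(a | s)`. -/
def score (i : Fin n) (s : S i) (a : A) (θ : Param d) : Param d :=
  gradient (𝓜.logPolicy i s a) θ

/-- `p_i(τ | θ) = ρ_i(s^0) ∏_h π_θ(a^h | s^h) P_i(s^{h+1} | s^h, a^h)`. -/
def trajProb (i : Fin n) (θ : Param d) (τ : 𝓜.AgentTraj i) : ℝ :=
  𝓜.init i (τ.1 0) * ∏ h : Fin 𝓜.H,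
    (𝓜.policy θ i (τ.1 h.castSucc) (τ.2 h) * 𝓜.trans i (τ.1 h.castSucc) (τ.2 h) (τ.1 h.succ))

/-- The expectation `E_{τ ∼ p_i(· | θ)} [f τ]`. -/
def trajExp (i : Fin n) (θ : Param d) {X : Type*} [AddCommMonoid X] [Module ℝ X]
    (f : 𝓜.AgentTraj i → X) : X :=
  ∑ τ : 𝓜.AgentTraj i, 𝓜.trajProb i θ τ • f τ

/-- The variance of a real function of `τ ∼ p_i(· | θ)`. -/
def trajVar (i : Fin n) (θ : Param d) (f : 𝓜.AgentTraj i → ℝ) : ℝ :=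
  𝓜.trajExp i θ fun τ => (f τ - 𝓜.trajExp i θ f) ^ 2

/-- The discounted return `R(τ)` of agent `i`. -/
def ret (i : Fin n) (τ : 𝓜.AgentTraj i) : ℝ :=
  ∑ h : Fin 𝓜.H, 𝓜.γ ^ (h : ℕ) * 𝓜.reward i (τ.1 h.castSucc) (τ.2 h) (τ.1 h.succ)

/-- The value function `V_i` of agent `i`. -/
def localValue (i : Fin n) (θ : Param d) : ℝ := 𝓜.trajExp i θ (𝓜.ret i)

/-- The global value function `V = (1/n) ∑ V_i`. -/
def value (θ : Param d) : ℝ := (1 / (n : ℝ)) * ∑ i, 𝓜.localValue i θ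

/-- The REINFORCE estimator with baseline, `g_i(τ | θ)`. -/
def gradEst (i : Fin n) (τ : 𝓜.AgentTraj i) (θ : Param d) : Param d :=
  (𝓜.ret i τ - 𝓜.baseline i) • ∑ h : Fin 𝓜.H, 𝓜.score i (τ.1 h.castSucc) (τ.2 h) θ

/-- The importance weight `ω(τ | θ', θ) = ∏_h π_θ'(a^h | s^h) / π_θ(a^h | s^h)`. -/
def impWeight (i : Fin n) (τ : 𝓜.AgentTraj i) (θ' θ : Param d) : ℝ :=
  ∏ h : Fin 𝓜.H,
    𝓜.policy θ' i (τ.1 h.castSucc) (τ.2 h) / 𝓜.policy θ i (τ.1 h.castSucc) (τ.2 h)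

/-- The Fisher information matrix
`F_i(θ) = E_{τ ∼ p_i(· | θ)} [(1/H) ∑_h ∇ log π_θ(a^h | s^h) (∇ log π_θ(a^h | s^h))ᵀ]`. -/
def fisher (i : Fin n) (θ : Param d) : Matrix (Fin d) (Fin d) ℝ :=
  𝓜.trajExp i θ fun τ => (1 / (𝓜.H : ℝ)) • ∑ h : Fin 𝓜.H,
    Matrix.vecMulVec (𝓜.score i (τ.1 h.castSucc) (τ.2 h) θ).ofLp
      (𝓜.score i (τ.1 h.castSucc) (τ.2 h) θ).ofLp

/-! ### Assumptions on the model -/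

/-- The policy is positive, its logarithm is twice differentiable in the parameter, and
`‖∇ log π_θ(a | s)‖² ≤ G`, `‖∇² log π_θ(a | s)‖ ≤ M` for all `θ`, `a`, `s`. The Hessian is the
derivative of the gradient, with the operator norm. -/
structure LogPolicyBounded (G M : ℝ) : Prop where
  pos : ∀ θ i s a, 0 < 𝓜.policy θ i s a
  differentiable_log : ∀ i s a, Differentiable ℝ (𝓜.logPolicy i s a)
  differentiable_score : ∀ i s a, Differentiable ℝ (𝓜.score i s a)
  score_le : ∀ θ i s a, ‖𝓜.score i s a θ‖ ^ 2 ≤ G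
  hessian_le : ∀ θ i s a, ‖fderiv ℝ (𝓜.score i s a) θ‖ ≤ M

/-- The variance of the importance weight is at most `Wv`. -/
def ImpWeightVarBounded (Wv : ℝ) : Prop :=
  ∀ i (θ θ' : Param d), 𝓜.trajVar i θ (fun τ => 𝓜.impWeight i τ θ' θ) ≤ Wv

/-- The variance of the gradient estimator of agent `i` is at most `ν_i²`. -/
def GradEstVarBounded (ν : Fin n → ℝ) : Prop :=
  ∀ i (θ : Param d),
    𝓜.trajExp i θ (fun τ => ‖𝓜.gradEst i τ θ - gradient (𝓜.localValue i) θ‖ ^ 2) ≤ ν i ^ 2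

/-- `F_i(θ) ≽ μF I` for every agent and every parameter. -/
def FisherLowerBound (μF : ℝ) : Prop :=
  ∀ i (θ : Param d), (𝓜.fisher i θ - μF • (1 : Matrix (Fin d) (Fin d) ℝ)).PosSemidef

/-! ### Constants -/

/-- `L = H (M + H G) / (1 - γ)`. -/
def constL (G M : ℝ) : ℝ := 𝓜.H * (M + 𝓜.H * G) / (1 - 𝓜.γ)

/-- `|b|`, the largest absolute value of a baseline. -/
def baselineBound : ℝ := ⨆ i, |𝓜.baseline i|

/-- `L_g = H M (1 + |b|) / (1 - γ)`. -/
def constLg (M : ℝ) : ℝ := 𝓜.H * M * (1 + 𝓜.baselineBound) / (1 - 𝓜.γ)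

/-- `C_g = H G^{1/2} (1 + |b|) / (1 - γ)`. -/
def constCg (G : ℝ) : ℝ := 𝓜.H * √G * (1 + 𝓜.baselineBound) / (1 - 𝓜.γ)

/-- `C_ω² = H (2 H G + M) (Wv + 1)`. -/
def constCωSq (G M Wv : ℝ) : ℝ := 𝓜.H * (2 * 𝓜.H * G + M) * (Wv + 1)

/-- `Φ² = L_g² + C_g² C_ω²`. -/
def constΦSq (G M Wv : ℝ) : ℝ := 𝓜.constLg M ^ 2 + 𝓜.constCg G ^ 2 * 𝓜.constCωSq G M Wv

end Model

/-! ### The communication network -/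

/-- `W` is a weight matrix of the graph with `W 1 = 1` and `1ᵀ W = 1ᵀ`. -/
structure IsMixing {n : ℕ} (𝒢 : SimpleGraph (Fin n)) (W : Matrix (Fin n) (Fin n) ℝ) : Prop where
  zero_of_not_adj : ∀ i j, i ≠ j → ¬ 𝒢.Adj i j → W i j = 0
  row_sum : ∀ i, ∑ j, W i j = 1
  col_sum : ∀ j, ∑ i, W i j = 1

/-- `ρ = ‖W - (1/n) 1 1ᵀ‖` in the spectral norm. -/
def mixRate {n : ℕ} (W : Matrix (Fin n) (Fin n) ℝ) : ℝ :=
  ‖Matrix.toEuclideanCLM (n := Fin n) (𝕜 := ℝ) (W - Matrix.of fun _ _ => 1 / (n : ℝ))‖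

open Classical in
/-- The neighbours `𝒩(i)` of an agent, itself included. -/
def nbhd {n : ℕ} (𝒢 : SimpleGraph (Fin n)) (i : Fin n) : Finset (Fin n) :=
  Finset.univ.filter fun j => 𝒢.Adj i j ∨ i = j

/-- The weighted average over the neighbours, `x_i ↦ ∑_{j ∈ 𝒩(i)} W_ij x_j`. -/
def mix {n d : ℕ} (𝒢 : SimpleGraph (Fin n)) (W : Matrix (Fin n) (Fin n) ℝ)
    (x : Fin n → Param d) (i : Fin n) : Param d :=
  ∑ j ∈ nbhd 𝒢 i, W i j • x j

/-! ### The algorithm -/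

/-- The inputs of the algorithm: the network and its weights, the number `T` of iterations, the
batch size `B`, the learning rate `η`, the momentum parameter `β`, the initial parameter `θ₀`. -/
structure Input (n d : ℕ) where
  𝒢 : SimpleGraph (Fin n)
  W : Matrix (Fin n) (Fin n) ℝ
  T : ℕ
  B : ℕ
  η : ℝ
  β : ℝ
  θ₀ : Param d

/-- The variables of all agents after round `t`: `θ^t`, `θ^{t+1}`, `v^t`, `y^{t+1}`. -/
structure State (n d : ℕ) where
  θ : Fin n → Param d
  θnext : Fin n → Param d
  v : Fin n → Param d
  y : Fin n → Param d

variable {n d : ℕ} {S : Fin n → Type u} {A : Type v} [∀ i, Fintype (S i)] [Fintype A]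
  (𝓜 : Model n d S A) (I : Input n d)

/-- The natural gradient step with consensus, `∑_{j ∈ 𝒩(i)} W_ij (θ_j + η F_j(θ_j)⁻¹ y_j)`. -/
def paramUpdate (θ y : Fin n → Param d) : Fin n → Param d :=
  mix I.𝒢 I.W fun j => θ j + I.η • Matrix.toEuclideanLin (𝓜.fisher j (θ j))⁻¹ (y j)

/-- Round `0`, from the mini-batches `τ⁰ i b`. -/
def initState (τ₀ : ∀ i, Fin I.B → 𝓜.AgentTraj i) : State n d :=
  let θ : Fin n → Param d := fun _ => I.θ₀
  let v : Fin n → Param d := fun i => (1 / (I.B : ℝ)) • ∑ b, 𝓜.gradEst i (τ₀ i b) (θ i)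
  let y : Fin n → Param d := mix I.𝒢 I.W v
  { θ := θ, θnext := paramUpdate 𝓜 I θ y, v := v, y := y }

/-- Round `t` from the variables after round `t - 1` and one trajectory `τ_i^t` per agent. -/
def step (s : State n d) (τ : ∀ i, 𝓜.AgentTraj i) : State n d :=
  let θ : Fin n → Param d := s.θnext
  let v : Fin n → Param d := fun i =>
    I.β • 𝓜.gradEst i (τ i) (θ i) + (1 - I.β) • (s.v i + 𝓜.gradEst i (τ i) (θ i) -
      𝓜.impWeight i (τ i) (s.θ i) (θ i) • 𝓜.gradEst i (τ i) (s.θ i))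
  let y : Fin n → Param d := mix I.𝒢 I.W fun j => s.y j + v j - s.v j
  { θ := θ, θnext := paramUpdate 𝓜 I θ y, v := v, y := y }

/-- All trajectories drawn in one run: the initial mini-batches, and for each `t < T` the
trajectories of round `t + 1`. -/
abbrev SamplePath := (∀ i, Fin I.B → 𝓜.AgentTraj i) × (Fin I.T → ∀ i, 𝓜.AgentTraj i)

/-- The variables after round `t ≤ T`. -/
def run (ω : SamplePath 𝓜 I) : ℕ → State n d
  | 0 => initState 𝓜 I ω.1
  | t + 1 => if h : t < I.T then step 𝓜 I (run ω t) (ω.2 ⟨t, h⟩) else run ω t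

/-- The law of a run. The initial trajectories are independent with `τ_{i,b}^0 ∼ p_i(· | θ₀)`, and
given the past, the `τ_i^{t+1} ∼ p_i(· | θ_i^{t+1})` are independent over the agents. -/
def pathProb (ω : SamplePath 𝓜 I) : ℝ :=
  (∏ i, ∏ b, 𝓜.trajProb i I.θ₀ (ω.1 i b)) *
    ∏ t : Fin I.T, ∏ i, 𝓜.trajProb i ((run 𝓜 I ω t).θnext i) (ω.2 t i)

/-- A run together with the indices `(i, t)`, `0 ≤ t ≤ T`, that select the output. -/
abbrev Outcome := SamplePath 𝓜 I × (Fin n × Fin (I.T + 1))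

/-- The output `θ_out = θ_i^t`. -/
def thetaOut (o : Outcome 𝓜 I) : Param d := (run 𝓜 I o.1 o.2.2).θ o.2.1

/-- The law of the outcome: `(i, t)` is uniform and independent of the run. -/
def outcomeProb (o : Outcome 𝓜 I) : ℝ :=
  pathProb 𝓜 I o.1 * (1 / ((n : ℝ) * ((I.T : ℝ) + 1)))

/-- The expectation `E [f(θ_out)]`. -/
def expOut (f : Param d → ℝ) : ℝ :=
  ∑ o : Outcome 𝓜 I, outcomeProb 𝓜 I o * f (thetaOut 𝓜 I o)

end MDNPG

end

noncomputable section

namespace MDNPG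

universe u v

/-! ### Expectations over finite product distributions -/

section ProductExpectation

variable {ι : Type*} [Fintype ι] [DecidableEq ι] {X : ι → Type*} [∀ i, Fintype (X i)]
  {E : Type*} [NormedAddCommGroup E] [InnerProductSpace ℝ E]

/-! The proof is a smooth ascent argument for the averaged iterate, coupled to four error
recursions. Everything is finite, so expectations are finite sums and a run is a Markov process
driven by the sampled trajectories.

Ascent. Column sums of `W` are one, so the average parameter moves by `η` times the average natural
gradient direction, and the average of the trackers `y_i` equals that of the estimators `v_i`. Since
`V` has an `L`-Lipschitz gradient and the Fisher matrices lie between `μF` and `G`, polarization of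
the form of `F⁻¹` bounds the gain of a round below by a multiple of `‖∇V(θ̄)‖² + (1/n) ∑ ‖y_i‖²`,
minus a multiple of `(1/n) ∑ ‖y_i - ∇V(θ̄)‖²` and a second-order term (`descent`). The loss splits
into the deviation of `y` from its average, the averaged estimation error and the deviation of `θ`.

Errors. In one round the estimation error is multiplied by `1 - β` and receives centred noise,
independent across agents (`gradErr_step`); averaging over agents therefore gains a factor `1/n`
over the mean of the individual noise variances. The noise has a part of order `β² ν²` and a part of
order `Φ² ‖θ^{t+1} - θ^t‖²`. The second needs `E(1 - ω)² ≤ C_ω² ‖θ' - θ‖²`: as a function of `θ'`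
the left side is an exponential sum in the log-likelihood, minus one, it vanishes together with its
gradient at `θ' = θ`, and the variance assumption makes its gradient Lipschitz. The deviations of
`θ` and `y` contract by `(1 + ρ²)/2` up to perturbations (`IsMixing.dev_mix_add_le`).

Closing. Summed over the rounds, each recursion bounds an error by initial data, `β`-noise and a
multiple of the total of `E ∑ ‖y_i‖²`. The ascent inequality has that total on its good side, and
the conditions on `η` and `β` make all the multiples small enough to be absorbed
(`combine_error_bounds`). The gradient at `θ̄` is then transferred to the individual `θ_i`. -/

theorem sum_pi_prod_eq_one {p : ∀ i, X i → ℝ} (hp : ∀ i, ∑ x, p i x = 1) :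
    ∑ τ : ∀ i, X i, ∏ i, p i (τ i) = 1 := by
  have h := Finset.prod_univ_sum (fun i => (Finset.univ : Finset (X i))) p
  rw [Fintype.piFinset_univ] at h
  rw [← h]
  simp [hp]

/-- Fubini for one coordinate: integrating out coordinate `i` first is what makes the mixed terms of
independent centred variables vanish. -/
theorem sum_pi_split (p : ∀ i, X i → ℝ) (i : ι) (F : (∀ j, X j) → E) :
    ∑ τ : ∀ j, X j, (∏ j, p j (τ j)) • F τ =
      ∑ r : ∀ j : {j // j ≠ i}, X j, (∏ j : {j // j ≠ i}, p j (r j)) •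
        ∑ x, p i x • F ((Equiv.piSplitAt i X).symm (x, r)) := by
  rw [← Equiv.sum_comp (Equiv.piSplitAt i X).symm, Fintype.sum_prod_type, Finset.sum_comm]
  refine Finset.sum_congr rfl fun r _ => ?_
  rw [Finset.smul_sum]
  refine Finset.sum_congr rfl fun x _ => ?_
  rw [smul_smul]
  congr 1
  rw [← Fintype.prod_subtype_mul_prod_subtype (fun j => j = i), mul_comm]
  congr 1
  · refine Finset.prod_congr rfl fun j _ => ?_
    simp only [Equiv.piSplitAt, Equiv.coe_fn_symm_mk]
    rw [dif_neg j.2]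
  · rw [Finset.prod_eq_single ⟨i, rfl⟩ (by rintro ⟨j, rfl⟩ _ h; exact absurd rfl h)
      (fun h => absurd (@Finset.mem_univ _ (_) _) h)]
    simp [Equiv.piSplitAt]

theorem sum_pi_coord {p : ∀ i, X i → ℝ} (hp : ∀ i, ∑ x, p i x = 1) (i : ι) (f : X i → E) :
    ∑ τ : ∀ j, X j, (∏ j, p j (τ j)) • f (τ i) = ∑ x, p i x • f x := by
  rw [sum_pi_split p i (fun τ => f (τ i))]
  simp only [Equiv.piSplitAt, Equiv.coe_fn_symm_mk, dite_true]
  rw [← Finset.sum_smul,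
    sum_pi_prod_eq_one (p := fun j : {j // j ≠ i} => p j) (fun j => hp j), one_smul]

theorem sum_pi_coord_mul {p : ∀ i, X i → ℝ} (hp : ∀ i, ∑ x, p i x = 1) (i : ι) (f : X i → ℝ) :
    ∑ τ : ∀ j, X j, (∏ j, p j (τ j)) * f (τ i) = ∑ x, p i x * f x := by
  simpa using sum_pi_coord hp i f

theorem sum_pi_inner_eq_zero (p : ∀ i, X i → ℝ) (ξ : ∀ i, X i → E) {i j : ι} (hij : j ≠ i)
    (hξ : ∑ x, p i x • ξ i x = 0) :
    ∑ τ : ∀ j, X j, (∏ j, p j (τ j)) * inner ℝ (ξ i (τ i)) (ξ j (τ j)) = 0 := by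
  have h := sum_pi_split p i (fun τ => inner ℝ (ξ i (τ i)) (ξ j (τ j)))
  simp only [smul_eq_mul] at h
  rw [h]
  refine Finset.sum_eq_zero fun r _ => ?_
  have h2 : ∑ x, p i x * inner ℝ (ξ i ((Equiv.piSplitAt i X).symm (x, r) i))
      (ξ j ((Equiv.piSplitAt i X).symm (x, r) j)) =
      inner ℝ (∑ x, p i x • ξ i x) (ξ j (r ⟨j, hij⟩)) := by
    simp only [Equiv.piSplitAt, Equiv.coe_fn_symm_mk, dite_true, hij, dite_false, sum_inner,
      inner_smul_left]
    simp
  rw [h2, hξ, inner_zero_left, mul_zero]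

/-- The second moment of a sum of independent centred variables, shifted by a constant. -/
theorem sum_pi_norm_add_sum_sq {p : ∀ i, X i → ℝ} (hp : ∀ i, ∑ x, p i x = 1) (a : E)
    (ξ : ∀ i, X i → E) (hξ : ∀ i, ∑ x, p i x • ξ i x = 0) :
    ∑ τ : ∀ j, X j, (∏ j, p j (τ j)) * ‖a + ∑ i, ξ i (τ i)‖ ^ 2 =
      ‖a‖ ^ 2 + ∑ i, ∑ x, p i x * ‖ξ i x‖ ^ 2 := by
  have h : ∀ τ : ∀ j, X j, (∏ j, p j (τ j)) * ‖a + ∑ i, ξ i (τ i)‖ ^ 2 =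
      (∏ j, p j (τ j)) * ‖a‖ ^ 2 + 2 * inner ℝ a (∑ i, (∏ j, p j (τ j)) • ξ i (τ i)) +
      ∑ i, ∑ k, (∏ j, p j (τ j)) * inner ℝ (ξ i (τ i)) (ξ k (τ k)) := by
    intro τ
    rw [norm_add_sq_real, ← real_inner_self_eq_norm_sq (∑ i, ξ i (τ i)), sum_inner,
      ← Finset.smul_sum, inner_smul_right]
    simp only [inner_sum, ← Finset.mul_sum]
    ring
  simp only [h, Finset.sum_add_distrib, ← Finset.sum_mul, sum_pi_prod_eq_one hp, one_mul]
  rw [← Finset.mul_sum, ← inner_sum, Finset.sum_comm (t := (Finset.univ : Finset ι))]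
  simp only [sum_pi_coord hp, hξ, Finset.sum_const_zero, inner_zero_right, mul_zero, add_zero]
  congr 1
  rw [Finset.sum_comm]
  refine Finset.sum_congr rfl fun i _ => ?_
  rw [Finset.sum_comm, Finset.sum_eq_single i]
  · rw [sum_pi_coord_mul hp i (fun x => inner ℝ (ξ i x) (ξ i x))]
    simp
  · intro k _ hk
    exact sum_pi_inner_eq_zero p ξ hk (hξ i)
  · simp

/-- The variance is at most the second moment. -/
theorem sum_norm_sub_mean_sq_le {Y : Type*} [Fintype Y] {p : Y → ℝ} (hp : ∑ x, p x = 1)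
    (f : Y → E) {m : E} (hm : ∑ x, p x • f x = m) :
    ∑ x, p x * ‖f x - m‖ ^ 2 ≤ ∑ x, p x * ‖f x‖ ^ 2 := by
  have h : ∀ x, p x * ‖f x - m‖ ^ 2 =
      p x * ‖f x‖ ^ 2 - 2 * inner ℝ (p x • f x) m + p x * ‖m‖ ^ 2 := by
    intro x
    rw [norm_sub_sq_real, inner_smul_left]
    simp
    ring
  simp only [h, Finset.sum_add_distrib, Finset.sum_sub_distrib, ← Finset.mul_sum, ← Finset.sum_mul,
    hp, ← sum_inner, hm, real_inner_self_eq_norm_sq]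
  nlinarith [sq_nonneg ‖m‖]

end ProductExpectation

/-! ### Finite-horizon Markov processes driven by samples -/

section SamplePaths

variable {Ψ X : Type*}

/-- The state after `t ≤ T` steps; it stays constant from time `T` on. -/
def iterStep (st : Ψ → X → Ψ) {T : ℕ} (s : Ψ) (ω : Fin T → X) : ℕ → Ψ
  | 0 => s
  | t + 1 => if h : t < T then st (iterStep st s ω t) (ω ⟨t, h⟩) else iterStep st s ω t

theorem iterStep_cons_succ (st : Ψ → X → Ψ) {T : ℕ} (s : Ψ) (x : X) (ω : Fin T → X) (t : ℕ) :
    iterStep st s (Fin.cons x ω : Fin (T + 1) → X) (t + 1) = iterStep st (st s x) ω t := by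
  induction t with
  | zero => simp [iterStep]
  | succ t ih =>
    rw [iterStep, ih, iterStep]
    by_cases h : t < T
    · have h' : t + 1 < T + 1 := by omega
      have hc : (Fin.cons x ω : Fin (T + 1) → X) ⟨t + 1, h'⟩ = ω ⟨t, h⟩ :=
        Fin.cons_succ (α := fun _ => X) x ω ⟨t, h⟩
      simp [h, hc]
    · simp [h]

variable [Fintype X]

/-- The expectation of `φ` at time `t` if the sample in state `s` has the law `q s`. -/
def procExp (st : Ψ → X → Ψ) (q : Ψ → X → ℝ) (T : ℕ) (s : Ψ) (t : ℕ) (φ : Ψ → ℝ) : ℝ :=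
  ∑ ω : Fin T → X, (∏ k : Fin T, q (iterStep st s ω k) (ω k)) * φ (iterStep st s ω t)

theorem sum_fin_succ_pi (T : ℕ) (F : (Fin (T + 1) → X) → ℝ) :
    ∑ ω, F ω = ∑ x, ∑ ω : Fin T → X, F (Fin.cons x ω) := by
  rw [← Equiv.sum_comp (Fin.consEquiv fun _ => X), Fintype.sum_prod_type]
  rfl

/-- Conditioning on the first sample. Peeling from the front restarts the same process with a
shorter horizon, which is why the later inductions generalize over the initial state. -/
theorem procExp_succ_succ (st : Ψ → X → Ψ) (q : Ψ → X → ℝ) (T : ℕ) (s : Ψ) (t : ℕ)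
    (φ : Ψ → ℝ) :
    procExp st q (T + 1) s (t + 1) φ = ∑ x, q s x * procExp st q T (st s x) t φ := by
  simp only [procExp]
  rw [sum_fin_succ_pi]
  refine Finset.sum_congr rfl fun x _ => ?_
  rw [Finset.mul_sum]
  refine Finset.sum_congr rfl fun ω _ => ?_
  rw [Fin.prod_univ_succ]
  simp only [Fin.val_succ, iterStep_cons_succ, Fin.cons_zero, Fin.cons_succ, Fin.val_zero]
  simp only [iterStep, mul_assoc]

theorem procExp_zero {st : Ψ → X → Ψ} {q : Ψ → X → ℝ} (hq : ∀ s, ∑ x, q s x = 1) (T : ℕ)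
    (s : Ψ) (φ : Ψ → ℝ) : procExp st q T s 0 φ = φ s := by
  simp only [procExp, iterStep, ← Finset.sum_mul]
  -- The time-zero value does not see the samples, so only the total mass of the path law is left.
  suffices h : ∑ ω : Fin T → X, ∏ k : Fin T, q (iterStep st s ω k) (ω k) = 1 by rw [h, one_mul]
  induction T generalizing s with
  | zero => simp
  | succ T ih =>
    rw [sum_fin_succ_pi]
    simp only [Fin.prod_univ_succ, Fin.val_succ, iterStep_cons_succ, Fin.cons_zero, Fin.cons_succ,
      Fin.val_zero, iterStep, ← Finset.mul_sum, ih, mul_one, hq]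

/-- The Markov property. -/
theorem procExp_succ {st : Ψ → X → Ψ} {q : Ψ → X → ℝ} (hq : ∀ s, ∑ x, q s x = 1) {T t : ℕ}
    (ht : t < T) (s : Ψ) (φ : Ψ → ℝ) :
    procExp st q T s (t + 1) φ = procExp st q T s t fun s' => ∑ x, q s' x * φ (st s' x) := by
  induction t generalizing T s with
  | zero =>
    obtain ⟨T, rfl⟩ : ∃ T', T = T' + 1 := ⟨T - 1, by omega⟩
    rw [procExp_succ_succ, procExp_zero hq]
    simp only [procExp_zero hq]
  | succ t ih =>
    obtain ⟨T, rfl⟩ : ∃ T', T = T' + 1 := ⟨T - 1, by omega⟩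
    rw [procExp_succ_succ, procExp_succ_succ]
    simp only [ih (show t < T by omega)]

end SamplePaths

/-! ### Smooth functions -/

section Smooth

variable {E : Type*} [NormedAddCommGroup E] [InnerProductSpace ℝ E] [CompleteSpace E]

/-- The descent lemma: a quadratic upper bound for a function with a Lipschitz gradient. -/
theorem le_of_lipschitz_gradient {f : E → ℝ} {g : E → E} (hf : ∀ x, HasGradientAt f (g x) x)
    {K : ℝ} (hg : ∀ x y, ‖g x - g y‖ ≤ K * ‖x - y‖) (x y : E) :
    f y ≤ f x + inner ℝ (g x) (y - x) + K / 2 * ‖y - x‖ ^ 2 := by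
  set v := y - x with hv
  -- `f` along the segment minus its linear and quadratic terms. Cauchy–Schwarz and the Lipschitz
  -- bound make the derivative nonpositive, and `φ 1 ≤ φ 0` is the claim.
  let φ : ℝ → ℝ := fun t => f (x + t • v) - t * inner ℝ (g x) v - K / 2 * ‖v‖ ^ 2 * t ^ 2
  have hφ : ∀ t, HasDerivAt φ (inner ℝ (g (x + t • v)) v - inner ℝ (g x) v -
      K * ‖v‖ ^ 2 * t) t := by
    intro t
    have h1 : HasDerivAt (fun t : ℝ => x + t • v) v t := by
      simpa using ((hasDerivAt_id t).smul_const v).const_add x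
    have h2 := (hf (x + t • v)).hasFDerivAt.comp_hasDerivAt t h1
    have h3 : HasDerivAt (fun t : ℝ => t * inner ℝ (g x) v) (inner ℝ (g x) v) t := by
      simpa using (hasDerivAt_id t).mul_const (inner ℝ (g x) v)
    have h4 : HasDerivAt (fun t : ℝ => K / 2 * ‖v‖ ^ 2 * t ^ 2) (K * ‖v‖ ^ 2 * t) t := by
      refine ((hasDerivAt_pow 2 t).const_mul (K / 2 * ‖v‖ ^ 2)).congr_deriv ?_
      norm_num
      ring
    exact (h2.sub h3).sub h4
  have hanti : AntitoneOn φ (Set.Icc 0 1) := by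
    refine antitoneOn_of_deriv_nonpos (convex_Icc 0 1)
      (fun t _ => (hφ t).continuousAt.continuousWithinAt)
      (fun t _ => (hφ t).differentiableAt.differentiableWithinAt) fun t ht => ?_
    rw [interior_Icc] at ht
    rw [(hφ t).deriv, ← inner_sub_left]
    have h1 := real_inner_le_norm (g (x + t • v) - g x) v
    have h2 := hg (x + t • v) x
    rw [add_sub_cancel_left, norm_smul, Real.norm_of_nonneg ht.1.le] at h2
    nlinarith [norm_nonneg v, mul_le_mul_of_nonneg_right h2 (norm_nonneg v)]
  have h := hanti (Set.left_mem_Icc.2 zero_le_one) (Set.right_mem_Icc.2 zero_le_one) zero_le_one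
  simp only [φ, hv] at h
  simp only [one_smul, zero_smul, add_sub_cancel, add_zero] at h
  linarith

variable {Ω : Type*} [Fintype Ω]

/-- Used with `ℓ` the log-likelihood: `a = 1` covers total probabilities and values, `a = 2` the
second moment of an importance weight. -/
theorem hasGradientAt_sum_exp {ℓ : Ω → E → ℝ} {s : Ω → E → E}
    (hℓ : ∀ τ x, HasGradientAt (ℓ τ) (s τ x) x) (w : Ω → ℝ) (a : ℝ) (x : E) :
    HasGradientAt (fun x => ∑ τ, w τ * Real.exp (a * ℓ τ x))
      (∑ τ, (w τ * a * Real.exp (a * ℓ τ x)) • s τ x) x := by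
  rw [hasGradientAt_iff_hasFDerivAt, map_sum]
  refine HasFDerivAt.fun_sum fun τ _ => ?_
  have h := ((((hℓ τ x).hasFDerivAt).const_mul a).exp).const_mul (w τ)
  refine h.congr_fderiv ?_
  rw [map_smul, smul_smul, smul_smul]
  congr 1
  ring

/-- The gradient of an exponential sum is Lipschitz. -/
theorem norm_sum_exp_smul_sub_le {ℓ : Ω → E → ℝ} {s : Ω → E → E}
    (hℓ : ∀ τ x, HasGradientAt (ℓ τ) (s τ x) x) (hs : ∀ τ, Differentiable ℝ (s τ))
    {C D : ℝ} (hC : ∀ τ x, ‖s τ x‖ ≤ C) (hD : ∀ τ x, ‖fderiv ℝ (s τ) x‖ ≤ D)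
    (w : Ω → ℝ) {a Q : ℝ} (ha : 0 ≤ a) (hQ : ∀ x, ∑ τ, |w τ| * Real.exp (a * ℓ τ x) ≤ Q)
    (hCD : 0 ≤ a ^ 2 * C ^ 2 + a * D) (x y : E) :
    ‖∑ τ, (w τ * a * Real.exp (a * ℓ τ x)) • s τ x -
      ∑ τ, (w τ * a * Real.exp (a * ℓ τ y)) • s τ y‖ ≤
      Q * (a ^ 2 * C ^ 2 + a * D) * ‖x - y‖ := by
  -- The product rule gives a Hessian term `a D` from the derivative of `s` and a rank-one term `a²
  -- C²` from the exponential; both carry the weight `|w| exp (a ℓ)`, whose sum is at most `Q` at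
  -- every point.
  have hder : ∀ x, HasFDerivAt (fun x => ∑ τ, (w τ * a * Real.exp (a * ℓ τ x)) • s τ x)
      (∑ τ, ((w τ * a * Real.exp (a * ℓ τ x)) • fderiv ℝ (s τ) x +
        ((w τ * a) • (Real.exp (a * ℓ τ x) • (a •
          (InnerProductSpace.toDual ℝ E (s τ x))))).smulRight (s τ x))) x := by
    intro x
    refine HasFDerivAt.fun_sum fun τ _ => ?_
    exact (((((hℓ τ x).hasFDerivAt).const_mul a).exp).const_mul (w τ * a)).fun_smul
      (hs τ x).hasFDerivAt
  refine Convex.norm_image_sub_le_of_norm_hasFDerivWithin_le (s := Set.univ)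
    (fun z _ => (hder z).hasFDerivWithinAt) (fun z _ => ?_) convex_univ
    (Set.mem_univ y) (Set.mem_univ x)
  calc _ ≤ ∑ τ, |w τ| * Real.exp (a * ℓ τ z) * (a ^ 2 * C ^ 2 + a * D) := by
        refine norm_sum_le_of_le _ fun τ _ => ?_
        refine (norm_add_le _ _).trans ?_
        rw [norm_smul, ContinuousLinearMap.norm_smulRight_apply, norm_smul, norm_smul, norm_smul,
          LinearIsometryEquiv.norm_map, norm_mul, norm_mul, Real.norm_eq_abs, Real.norm_eq_abs,
          Real.norm_eq_abs, Real.abs_exp, abs_of_nonneg ha]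
        have h1 : ‖s τ z‖ ^ 2 ≤ C ^ 2 := by gcongr; exact hC τ z
        have h2 := hD τ z
        have h3 : (0 : ℝ) ≤ |w τ| * Real.exp (a * ℓ τ z) := by positivity
        have h4 : a * ‖fderiv ℝ (s τ) z‖ + a ^ 2 * ‖s τ z‖ ^ 2 ≤ a ^ 2 * C ^ 2 + a * D := by
          have := mul_le_mul_of_nonneg_left h2 ha
          have := mul_le_mul_of_nonneg_left h1 (sq_nonneg a)
          linarith
        calc _ = |w τ| * Real.exp (a * ℓ τ z) *
              (a * ‖fderiv ℝ (s τ) z‖ + a ^ 2 * ‖s τ z‖ ^ 2) := by ring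
          _ ≤ _ := mul_le_mul_of_nonneg_left h4 h3
    _ ≤ Q * (a ^ 2 * C ^ 2 + a * D) := by
        rw [← Finset.sum_mul]
        exact mul_le_mul_of_nonneg_right (hQ z) hCD

end Smooth

/-! ### The law of a trajectory -/

/-- Induction on the horizon from the front: after the first action and state, the remaining path
starts from a new state and has mass one by hypothesis. -/
theorem sum_path_prod_eq_one {S A : Type*} [Fintype S] [Fintype A] {k : S → A → S → ℝ}
    (hk : ∀ s, ∑ a, ∑ s', k s a s' = 1) (H : ℕ) (s₀ : S) :
    ∑ x : Fin H → S, ∑ a : Fin H → A,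
      ∏ h : Fin H, k ((Fin.cons s₀ x : Fin (H + 1) → S) h.castSucc) (a h) (x h) = 1 := by
  induction H generalizing s₀ with
  | zero => simp
  | succ H ih =>
    rw [sum_fin_succ_pi]
    simp only [sum_fin_succ_pi (X := A), Fin.prod_univ_succ, Fin.cons_zero, Fin.cons_succ,
      Fin.castSucc_zero, ← Fin.succ_castSucc]
    simp only [← Finset.mul_sum]
    rw [← hk s₀]
    conv_rhs => rw [Finset.sum_comm]
    refine Finset.sum_congr rfl fun s' _ => ?_
    rw [Finset.sum_comm]
    refine Finset.sum_congr rfl fun a _ => ?_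
    rw [← Finset.mul_sum, ih, mul_one]

namespace Model

variable {n d : ℕ} {S : Fin n → Type u} {A : Type v} [∀ i, Fintype (S i)] [Fintype A]
  (𝓜 : Model n d S A)

theorem sum_trajProb (i : Fin n) (θ : Param d) : ∑ τ, 𝓜.trajProb i θ τ = 1 := by
  have hk : ∀ s, ∑ a, ∑ s', 𝓜.policy θ i s a * 𝓜.trans i s a s' = 1 := by
    intro s
    simp only [← Finset.mul_sum, (𝓜.trans_mem i s _).2, mul_one, (𝓜.policy_mem θ i s).2]
  rw [Fintype.sum_prod_type, sum_fin_succ_pi]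
  simp only [trajProb, Fin.cons_zero, Fin.cons_succ, ← Finset.mul_sum]
  simp only [sum_path_prod_eq_one hk, mul_one, (𝓜.init_mem i).2]

theorem trajProb_nonneg (i : Fin n) (θ : Param d) (τ : 𝓜.AgentTraj i) : 0 ≤ 𝓜.trajProb i θ τ :=
  mul_nonneg ((𝓜.init_mem i).1 _) <| Finset.prod_nonneg fun _ _ =>
    mul_nonneg ((𝓜.policy_mem θ i _).1 _) ((𝓜.trans_mem i _ _).1 _)

/-- The log-likelihood of the actions of a trajectory. -/
def logLik (i : Fin n) (τ : 𝓜.AgentTraj i) (θ : Param d) : ℝ :=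
  ∑ h : Fin 𝓜.H, 𝓜.logPolicy i (τ.1 h.castSucc) (τ.2 h) θ

/-- The gradient of the log-likelihood. -/
def scoreSum (i : Fin n) (τ : 𝓜.AgentTraj i) (θ : Param d) : Param d :=
  ∑ h : Fin 𝓜.H, 𝓜.score i (τ.1 h.castSucc) (τ.2 h) θ

/-- The part of the probability of a trajectory that does not depend on the policy. -/
def envProb (i : Fin n) (τ : 𝓜.AgentTraj i) : ℝ :=
  𝓜.init i (τ.1 0) * ∏ h : Fin 𝓜.H, 𝓜.trans i (τ.1 h.castSucc) (τ.2 h) (τ.1 h.succ)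

theorem envProb_nonneg (i : Fin n) (τ : 𝓜.AgentTraj i) : 0 ≤ 𝓜.envProb i τ :=
  mul_nonneg ((𝓜.init_mem i).1 _) <| Finset.prod_nonneg fun _ _ => (𝓜.trans_mem i _ _).1 _

theorem one_sub_γ_pos : 0 < 1 - 𝓜.γ := sub_pos.2 𝓜.γ_lt_one

theorem abs_ret_le (i : Fin n) (τ : 𝓜.AgentTraj i) : |𝓜.ret i τ| ≤ 1 / (1 - 𝓜.γ) := by
  have h1 : |𝓜.ret i τ| ≤ ∑ h : Fin 𝓜.H, 𝓜.γ ^ (h : ℕ) := by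
    refine (Finset.abs_sum_le_sum_abs _ _).trans (Finset.sum_le_sum fun h _ => ?_)
    have := abs_le.2 (𝓜.reward_mem i (τ.1 h.castSucc) (τ.2 h) (τ.1 h.succ))
    have h2 : 0 ≤ 𝓜.γ ^ (h : ℕ) := pow_nonneg 𝓜.γ_nonneg _
    rw [abs_mul, abs_of_nonneg h2]
    exact mul_le_of_le_one_right h2 this
  refine h1.trans ?_
  rw [Fin.sum_univ_eq_sum_range (fun k => 𝓜.γ ^ k), le_div_iff₀ 𝓜.one_sub_γ_pos,
    geom_sum_mul_neg]
  linarith [pow_nonneg 𝓜.γ_nonneg 𝓜.H]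

theorem abs_baseline_le (i : Fin n) : |𝓜.baseline i| ≤ 𝓜.baselineBound :=
  le_ciSup (f := fun i => |𝓜.baseline i|) (Set.finite_range _).bddAbove i

theorem baselineBound_nonneg : 0 ≤ 𝓜.baselineBound := Real.iSup_nonneg fun _ => abs_nonneg _

theorem abs_ret_sub_baseline_le (i : Fin n) (τ : 𝓜.AgentTraj i) :
    |𝓜.ret i τ - 𝓜.baseline i| ≤ (1 + 𝓜.baselineBound) / (1 - 𝓜.γ) := by
  have h1 := 𝓜.abs_ret_le i τ
  have h2 := 𝓜.abs_baseline_le i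
  -- The baseline need not be divided by `1 - γ`; it is enlarged so that one factor `(1 + |b|) / (1
  -- - γ)` serves for both `C_g` and `L_g`.
  have h3 : 𝓜.baselineBound ≤ 𝓜.baselineBound / (1 - 𝓜.γ) :=
    le_div_self 𝓜.baselineBound_nonneg 𝓜.one_sub_γ_pos (by linarith [𝓜.γ_nonneg])
  rw [add_div]
  linarith [abs_sub (𝓜.ret i τ) (𝓜.baseline i)]

-- A probability vector cannot live on an empty type. The existence of a state and an action is what
-- makes `G` and `M` nonnegative.
include 𝓜 in
theorem exists_state_action (i : Fin n) : Nonempty (S i) ∧ Nonempty A := by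
  have h1 : Nonempty (S i) := by
    by_contra h
    rw [not_nonempty_iff] at h
    simpa using (𝓜.init_mem i).2
  refine ⟨h1, ?_⟩
  obtain ⟨s⟩ := h1
  by_contra h
  rw [not_nonempty_iff] at h
  simpa using (𝓜.policy_mem 0 i s).2

/-! ### Likelihood calculus: policy gradients, smoothness, importance weights -/

namespace LogPolicyBounded

variable {𝓜} {G M : ℝ} (hlog : 𝓜.LogPolicyBounded G M)
include hlog

theorem G_nonneg (i : Fin n) : 0 ≤ G := by
  obtain ⟨⟨s⟩, ⟨a⟩⟩ := 𝓜.exists_state_action i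
  exact (sq_nonneg _).trans (hlog.score_le 0 i s a)

theorem M_nonneg (i : Fin n) : 0 ≤ M := by
  obtain ⟨⟨s⟩, ⟨a⟩⟩ := 𝓜.exists_state_action i
  exact (norm_nonneg _).trans (hlog.hessian_le 0 i s a)

/-- Positivity of the policy lets its product be written as an exponential, so that the parameter
enters only through the log-likelihood and expectations of functions of the trajectory become
exponential sums. -/
theorem trajProb_eq (i : Fin n) (τ : 𝓜.AgentTraj i) (θ : Param d) :
    𝓜.trajProb i θ τ = 𝓜.envProb i τ * Real.exp (𝓜.logLik i τ θ) := by
  have h : Real.exp (𝓜.logLik i τ θ) =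
      ∏ h : Fin 𝓜.H, 𝓜.policy θ i (τ.1 h.castSucc) (τ.2 h) := by
    rw [logLik, Real.exp_sum]
    exact Finset.prod_congr rfl fun h _ => Real.exp_log (hlog.pos θ i _ _)
  rw [h, trajProb, envProb, Finset.prod_mul_distrib]
  ring

theorem impWeight_eq (i : Fin n) (τ : 𝓜.AgentTraj i) (θ' θ : Param d) :
    𝓜.impWeight i τ θ' θ = Real.exp (𝓜.logLik i τ θ' - 𝓜.logLik i τ θ) := by
  rw [logLik, logLik, ← Finset.sum_sub_distrib, Real.exp_sum]
  refine Finset.prod_congr rfl fun h _ => ?_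
  rw [Real.exp_sub, logPolicy, logPolicy, Real.exp_log (hlog.pos θ i _ _),
    Real.exp_log (hlog.pos θ' i _ _)]

/-- Change of measure, trajectory by trajectory: the environment factors agree under both
parameters. -/
theorem trajProb_mul_impWeight (i : Fin n) (τ : 𝓜.AgentTraj i) (θ' θ : Param d) :
    𝓜.trajProb i θ τ * 𝓜.impWeight i τ θ' θ = 𝓜.trajProb i θ' τ := by
  rw [hlog.trajProb_eq, hlog.trajProb_eq, hlog.impWeight_eq, mul_assoc, ← Real.exp_add]
  congr 2
  ring

theorem hasGradientAt_logLik (i : Fin n) (τ : 𝓜.AgentTraj i) (θ : Param d) :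
    HasGradientAt (𝓜.logLik i τ) (𝓜.scoreSum i τ θ) θ := by
  rw [hasGradientAt_iff_hasFDerivAt, scoreSum, map_sum]
  exact HasFDerivAt.fun_sum fun h _ => (hlog.differentiable_log i _ _ θ).hasGradientAt.hasFDerivAt

theorem differentiable_scoreSum (i : Fin n) (τ : 𝓜.AgentTraj i) :
    Differentiable ℝ (𝓜.scoreSum i τ) :=
  Differentiable.fun_sum fun _ _ => hlog.differentiable_score i _ _

theorem norm_scoreSum_le (i : Fin n) (τ : 𝓜.AgentTraj i) (θ : Param d) :
    ‖𝓜.scoreSum i τ θ‖ ≤ 𝓜.H * √G := by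
  refine (norm_sum_le_of_le (f := fun h : Fin 𝓜.H => 𝓜.score i (τ.1 h.castSucc) (τ.2 h) θ)
    (n := fun _ => √G) _ fun h _ => ?_).trans (by simp)
  exact Real.le_sqrt_of_sq_le (hlog.score_le θ i _ _)

theorem norm_fderiv_scoreSum_le (i : Fin n) (τ : 𝓜.AgentTraj i) (θ : Param d) :
    ‖fderiv ℝ (𝓜.scoreSum i τ) θ‖ ≤ 𝓜.H * M := by
  have h1 : fderiv ℝ (𝓜.scoreSum i τ) θ =
      ∑ h : Fin 𝓜.H, fderiv ℝ (𝓜.score i (τ.1 h.castSucc) (τ.2 h)) θ :=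
    (HasFDerivAt.fun_sum fun h _ => (hlog.differentiable_score i _ _ θ).hasFDerivAt).fderiv
  rw [h1]
  refine (norm_sum_le_of_le (n := fun _ => M) _ fun h _ => ?_).trans (by simp)
  exact hlog.hessian_le θ i _ _

theorem norm_scoreSum_sub_le (i : Fin n) (τ : 𝓜.AgentTraj i) (x y : Param d) :
    ‖𝓜.scoreSum i τ x - 𝓜.scoreSum i τ y‖ ≤ 𝓜.H * M * ‖x - y‖ :=
  Convex.norm_image_sub_le_of_norm_fderiv_le (s := Set.univ)
    (fun z _ => hlog.differentiable_scoreSum i τ z)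
    (fun z _ => hlog.norm_fderiv_scoreSum_le i τ z) convex_univ (Set.mem_univ y) (Set.mem_univ x)

/-- Differentiate the identity that the probabilities sum to one. This is why a baseline introduces
no bias. -/
theorem sum_trajProb_smul_scoreSum (i : Fin n) (θ : Param d) :
    ∑ τ, 𝓜.trajProb i θ τ • 𝓜.scoreSum i τ θ = 0 := by
  have h := hasGradientAt_sum_exp (fun τ x => hlog.hasGradientAt_logLik i τ x) (𝓜.envProb i) 1 θ
  simp only [one_mul, mul_one, ← hlog.trajProb_eq, sum_trajProb] at h
  exact h.unique (hasGradientAt_const θ (1 : ℝ))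

theorem localValue_eq (i : Fin n) : 𝓜.localValue i =
    fun θ => ∑ τ, (𝓜.envProb i τ * 𝓜.ret i τ) * Real.exp (1 * 𝓜.logLik i τ θ) := by
  ext θ
  refine Finset.sum_congr rfl fun τ _ => ?_
  rw [hlog.trajProb_eq, smul_eq_mul, one_mul]
  ring

theorem sum_trajProb_smul_gradEst (i : Fin n) (θ : Param d) :
    ∑ τ, 𝓜.trajProb i θ τ • 𝓜.gradEst i τ θ =
      ∑ τ, (𝓜.envProb i τ * 𝓜.ret i τ * 1 * Real.exp (1 * 𝓜.logLik i τ θ)) •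
        𝓜.scoreSum i τ θ := by
  have h : ∀ τ, 𝓜.trajProb i θ τ • 𝓜.gradEst i τ θ =
      (𝓜.envProb i τ * 𝓜.ret i τ * 1 * Real.exp (1 * 𝓜.logLik i τ θ)) • 𝓜.scoreSum i τ θ -
      𝓜.baseline i • 𝓜.trajProb i θ τ • 𝓜.scoreSum i τ θ := by
    intro τ
    rw [gradEst, ← scoreSum, hlog.trajProb_eq, one_mul, mul_one]
    module
  simp only [h, Finset.sum_sub_distrib, ← Finset.smul_sum, hlog.sum_trajProb_smul_scoreSum,
    smul_zero, sub_zero]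

theorem hasGradientAt_localValue (i : Fin n) (θ : Param d) :
    HasGradientAt (𝓜.localValue i) (∑ τ, 𝓜.trajProb i θ τ • 𝓜.gradEst i τ θ) θ := by
  rw [hlog.sum_trajProb_smul_gradEst, hlog.localValue_eq]
  exact hasGradientAt_sum_exp (fun τ x => hlog.hasGradientAt_logLik i τ x) _ 1 θ

theorem gradient_localValue (i : Fin n) (θ : Param d) :
    gradient (𝓜.localValue i) θ = ∑ τ, 𝓜.trajProb i θ τ • 𝓜.gradEst i τ θ :=
  (hlog.hasGradientAt_localValue i θ).gradient

theorem norm_gradient_localValue_sub_le (i : Fin n) (x y : Param d) :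
    ‖gradient (𝓜.localValue i) x - gradient (𝓜.localValue i) y‖ ≤
      𝓜.constL G M * ‖x - y‖ := by
  have hG := hlog.G_nonneg i
  have hM := hlog.M_nonneg i
  rw [hlog.gradient_localValue, hlog.gradient_localValue, hlog.sum_trajProb_smul_gradEst,
    hlog.sum_trajProb_smul_gradEst]
  -- With `a = 1`, `C = H √G`, `D = H M` and `Q` the bound on the return, the constant is `(H² G + H
  -- M) / (1 - γ) = L`.
  refine (norm_sum_exp_smul_sub_le (fun τ x => hlog.hasGradientAt_logLik i τ x)
    (hlog.differentiable_scoreSum i) (hlog.norm_scoreSum_le i) (hlog.norm_fderiv_scoreSum_le i)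
    _ zero_le_one (Q := 1 / (1 - 𝓜.γ)) (fun z => ?_) (by positivity) x y).trans (le_of_eq ?_)
  · calc _ ≤ ∑ τ, 𝓜.trajProb i z τ * (1 / (1 - 𝓜.γ)) := by
          refine Finset.sum_le_sum fun τ _ => ?_
          rw [abs_mul, abs_of_nonneg (𝓜.envProb_nonneg i τ), one_mul, mul_right_comm,
            ← hlog.trajProb_eq]
          exact mul_le_mul_of_nonneg_left (𝓜.abs_ret_le i τ) (𝓜.trajProb_nonneg i z τ)
      _ = _ := by rw [← Finset.sum_mul, sum_trajProb, one_mul]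
  · rw [constL, mul_pow, Real.sq_sqrt hG]
    ring

/-- The second moment of the error of the importance weight. -/
theorem sum_trajProb_mul_one_sub_impWeight_sq_le {Wv : ℝ} (himp : 𝓜.ImpWeightVarBounded Wv)
    (i : Fin n) (θ' θ : Param d) :
    ∑ τ, 𝓜.trajProb i θ τ * (1 - 𝓜.impWeight i τ θ' θ) ^ 2 ≤
      𝓜.constCωSq G M Wv * ‖θ' - θ‖ ^ 2 := by
  have hG := hlog.G_nonneg i
  have hM := hlog.M_nonneg i
  have hmean : ∀ x, ∑ τ, 𝓜.trajProb i θ τ * 𝓜.impWeight i τ x θ = 1 := by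
    intro x
    simp only [hlog.trajProb_mul_impWeight, sum_trajProb]
  -- The second moment of the weight, `p ω² = env · exp(-ℓ(θ)) exp(2 ℓ(x))`, is an exponential sum
  -- in `x` with `a = 2`; since the weight has mean one, it exceeds `E(1 - ω)²` by one.
  have hf : ∀ x, ∑ τ, (𝓜.envProb i τ * Real.exp (-𝓜.logLik i τ θ)) *
      Real.exp (2 * 𝓜.logLik i τ x) =
      ∑ τ, 𝓜.trajProb i θ τ * (1 - 𝓜.impWeight i τ x θ) ^ 2 + 1 := by
    intro x
    have h : ∀ τ, 𝓜.trajProb i θ τ * (1 - 𝓜.impWeight i τ x θ) ^ 2 =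
        (𝓜.envProb i τ * Real.exp (-𝓜.logLik i τ θ)) * Real.exp (2 * 𝓜.logLik i τ x) +
        (𝓜.trajProb i θ τ - 2 * (𝓜.trajProb i θ τ * 𝓜.impWeight i τ x θ)) := by
      intro τ
      have h2 : (𝓜.envProb i τ * Real.exp (-𝓜.logLik i τ θ)) * Real.exp (2 * 𝓜.logLik i τ x) =
          𝓜.trajProb i θ τ * 𝓜.impWeight i τ x θ ^ 2 := by
        rw [hlog.trajProb_eq, hlog.impWeight_eq, ← Real.exp_nat_mul, mul_assoc, mul_assoc,
          ← Real.exp_add, ← Real.exp_add]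
        congr 2
        push_cast
        ring
      rw [h2]
      ring
    simp only [h, Finset.sum_add_distrib, Finset.sum_sub_distrib, ← Finset.mul_sum, hmean,
      sum_trajProb]
    ring
  have hQ : ∀ x, ∑ τ, |𝓜.envProb i τ * Real.exp (-𝓜.logLik i τ θ)| *
      Real.exp (2 * 𝓜.logLik i τ x) ≤ Wv + 1 := by
    intro x
    have h1 : ∀ τ, |𝓜.envProb i τ * Real.exp (-𝓜.logLik i τ θ)| =
        𝓜.envProb i τ * Real.exp (-𝓜.logLik i τ θ) := fun τ =>
      abs_of_nonneg (mul_nonneg (𝓜.envProb_nonneg i τ) (Real.exp_pos _).le)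
    simp only [h1, hf]
    have h2 := himp i θ x
    simp only [trajVar, trajExp, smul_eq_mul, hmean] at h2
    have h3 : ∀ τ, (1 - 𝓜.impWeight i τ x θ) ^ 2 = (𝓜.impWeight i τ x θ - 1) ^ 2 := fun τ => by
      ring
    simp only [h3]
    linarith
  -- Quadratic upper bound at the base point `θ`. There the value is `1` and the gradient is zero,
  -- so what survives is half of `(Wv + 1)(4 H² G + 2 H M)`, which is `C_ω²`.
  have h := le_of_lipschitz_gradient
    (hasGradientAt_sum_exp (fun τ x => hlog.hasGradientAt_logLik i τ x) _ 2)
    (norm_sum_exp_smul_sub_le (fun τ x => hlog.hasGradientAt_logLik i τ x)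
    (hlog.differentiable_scoreSum i) (hlog.norm_scoreSum_le i) (hlog.norm_fderiv_scoreSum_le i)
    _ zero_le_two hQ (by positivity)) θ θ'
  have hgrad : ∑ τ, (𝓜.envProb i τ * Real.exp (-𝓜.logLik i τ θ) * 2 *
      Real.exp (2 * 𝓜.logLik i τ θ)) • 𝓜.scoreSum i τ θ = 0 := by
    have h1 : ∀ τ, 𝓜.envProb i τ * Real.exp (-𝓜.logLik i τ θ) * 2 *
      Real.exp (2 * 𝓜.logLik i τ θ) = 2 * 𝓜.trajProb i θ τ := by
      intro τ
      rw [hlog.trajProb_eq, two_mul (𝓜.logLik i τ θ), Real.exp_add, Real.exp_neg]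
      have := (Real.exp_pos (𝓜.logLik i τ θ)).ne'
      field_simp
    simp only [h1, mul_smul, ← Finset.smul_sum, hlog.sum_trajProb_smul_scoreSum, smul_zero]
  rw [hgrad, hf, hf, inner_zero_left] at h
  have h0 : ∀ τ, 𝓜.impWeight i τ θ θ = 1 := fun τ => by rw [hlog.impWeight_eq]; simp
  simp only [h0] at h
  rw [mul_pow, Real.sq_sqrt hG] at h
  rw [constCωSq]
  have h4 : (Wv + 1) * (2 ^ 2 * ((𝓜.H : ℝ) ^ 2 * G) + 2 * (𝓜.H * M)) / 2 * ‖θ' - θ‖ ^ 2 =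
      𝓜.H * (2 * 𝓜.H * G + M) * (Wv + 1) * ‖θ' - θ‖ ^ 2 := by ring
  rw [h4] at h
  simp only [sub_self, ne_eq, OfNat.ofNat_ne_zero, not_false_eq_true, zero_pow, mul_zero,
    Finset.sum_const_zero] at h
  linarith

theorem norm_gradEst_le (i : Fin n) (τ : 𝓜.AgentTraj i) (θ : Param d) :
    ‖𝓜.gradEst i τ θ‖ ≤ 𝓜.constCg G := by
  rw [gradEst, ← scoreSum, norm_smul, Real.norm_eq_abs]
  refine (mul_le_mul (𝓜.abs_ret_sub_baseline_le i τ) (hlog.norm_scoreSum_le i τ θ)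
    (norm_nonneg _) ((abs_nonneg _).trans (𝓜.abs_ret_sub_baseline_le i τ))).trans (le_of_eq ?_)
  rw [constCg]
  ring

theorem norm_gradEst_sub_le (i : Fin n) (τ : 𝓜.AgentTraj i) (x y : Param d) :
    ‖𝓜.gradEst i τ x - 𝓜.gradEst i τ y‖ ≤ 𝓜.constLg M * ‖x - y‖ := by
  rw [gradEst, gradEst, ← scoreSum, ← scoreSum, ← smul_sub, norm_smul, Real.norm_eq_abs]
  refine (mul_le_mul (𝓜.abs_ret_sub_baseline_le i τ) (hlog.norm_scoreSum_sub_le i τ x y)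
    (norm_nonneg _) ((abs_nonneg _).trans (𝓜.abs_ret_sub_baseline_le i τ))).trans (le_of_eq ?_)
  rw [constLg]
  ring

/-- Split as `(g(θ) - g(θ')) + (1 - ω) g(θ')`: the first part is Lipschitz for each trajectory, and
in the second `g` is bounded while `1 - ω` is small in mean square. -/
theorem sum_trajProb_mul_norm_gradEst_sub_sq_le {Wv : ℝ} (himp : 𝓜.ImpWeightVarBounded Wv)
    (i : Fin n) (θ' θ : Param d) :
    ∑ τ, 𝓜.trajProb i θ τ *
      ‖𝓜.gradEst i τ θ - 𝓜.impWeight i τ θ' θ • 𝓜.gradEst i τ θ'‖ ^ 2 ≤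
      2 * 𝓜.constΦSq G M Wv * ‖θ - θ'‖ ^ 2 := by
  have h : ∀ τ, 𝓜.trajProb i θ τ *
      ‖𝓜.gradEst i τ θ - 𝓜.impWeight i τ θ' θ • 𝓜.gradEst i τ θ'‖ ^ 2 ≤
      𝓜.trajProb i θ τ * (2 * (𝓜.constLg M ^ 2 * ‖θ - θ'‖ ^ 2)) +
      2 * 𝓜.constCg G ^ 2 * (𝓜.trajProb i θ τ * (1 - 𝓜.impWeight i τ θ' θ) ^ 2) := by
    intro τ
    have h1 : 𝓜.gradEst i τ θ - 𝓜.impWeight i τ θ' θ • 𝓜.gradEst i τ θ' =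
        (𝓜.gradEst i τ θ - 𝓜.gradEst i τ θ') +
          (1 - 𝓜.impWeight i τ θ' θ) • 𝓜.gradEst i τ θ' := by module
    have h2 : ‖𝓜.gradEst i τ θ - 𝓜.gradEst i τ θ'‖ ^ 2 ≤ 𝓜.constLg M ^ 2 * ‖θ - θ'‖ ^ 2 := by
      rw [← mul_pow]
      gcongr
      exact hlog.norm_gradEst_sub_le i τ θ θ'
    have h3 : ‖(1 - 𝓜.impWeight i τ θ' θ) • 𝓜.gradEst i τ θ'‖ ^ 2 ≤
        (1 - 𝓜.impWeight i τ θ' θ) ^ 2 * 𝓜.constCg G ^ 2 := by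
      rw [norm_smul, mul_pow, Real.norm_eq_abs, sq_abs]
      gcongr
      exact hlog.norm_gradEst_le i τ θ'
    have h4 : ‖𝓜.gradEst i τ θ - 𝓜.impWeight i τ θ' θ • 𝓜.gradEst i τ θ'‖ ^ 2 ≤
        2 * (𝓜.constLg M ^ 2 * ‖θ - θ'‖ ^ 2) +
          2 * ((1 - 𝓜.impWeight i τ θ' θ) ^ 2 * 𝓜.constCg G ^ 2) := by
      rw [h1]
      have h5 := norm_add_le (𝓜.gradEst i τ θ - 𝓜.gradEst i τ θ')
        ((1 - 𝓜.impWeight i τ θ' θ) • 𝓜.gradEst i τ θ')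
      have h6 := pow_le_pow_left₀ (norm_nonneg _) h5 2
      linarith [add_sq_le (a := ‖𝓜.gradEst i τ θ - 𝓜.gradEst i τ θ'‖)
        (b := ‖(1 - 𝓜.impWeight i τ θ' θ) • 𝓜.gradEst i τ θ'‖)]
    refine (mul_le_mul_of_nonneg_left h4 (𝓜.trajProb_nonneg i θ τ)).trans (le_of_eq ?_)
    ring
  refine (Finset.sum_le_sum fun τ _ => h τ).trans ?_
  rw [Finset.sum_add_distrib, ← Finset.sum_mul, ← Finset.mul_sum, sum_trajProb]
  have h7 := hlog.sum_trajProb_mul_one_sub_impWeight_sq_le himp i θ' θ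
  rw [norm_sub_rev] at h7
  have h8 := mul_le_mul_of_nonneg_left h7 (show 0 ≤ 2 * 𝓜.constCg G ^ 2 by positivity)
  rw [constΦSq]
  linarith

theorem sum_trajProb_smul_impWeight_smul_gradEst (i : Fin n) (θ' θ : Param d) :
    ∑ τ, 𝓜.trajProb i θ τ • 𝓜.impWeight i τ θ' θ • 𝓜.gradEst i τ θ' =
      gradient (𝓜.localValue i) θ' := by
  simp only [smul_smul, hlog.trajProb_mul_impWeight, hlog.gradient_localValue]

end LogPolicyBounded

end Model

/-! ### The natural gradient direction -/

section Inverse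

variable {E : Type*} [NormedAddCommGroup E] [InnerProductSpace ℝ E] {F P : E →ₗ[ℝ] E} {μ G : ℝ}

/-- Test coercivity of `F` at `P x` and apply Cauchy–Schwarz. -/
theorem norm_inverse_apply_le (hFP : ∀ x, F (P x) = x) (hμ : 0 < μ)
    (hlow : ∀ x, μ * ‖x‖ ^ 2 ≤ inner ℝ (F x) x) (x : E) : ‖P x‖ ≤ ‖x‖ / μ := by
  have h1 := hlow (P x)
  rw [hFP] at h1
  have h2 := real_inner_le_norm x (P x)
  rw [le_div_iff₀ hμ]
  rcases (norm_nonneg (P x)).eq_or_lt with h | h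
  · rw [← h, zero_mul]
    exact norm_nonneg x
  · nlinarith

/-- Expand the nonnegative form of `F` at `P x - x / G`; the upper bound on `F` absorbs the term in
`⟨F x, x⟩`. -/
theorem inner_inverse_apply_self_ge (hFP : ∀ x, F (P x) = x)
    (hsymm : ∀ x y, inner ℝ (F x) y = inner ℝ x (F y))
    (hnonneg : ∀ x, 0 ≤ inner ℝ (F x) x)
    (hup : ∀ x, inner ℝ (F x) x ≤ G * ‖x‖ ^ 2) (hG : 0 < G) (x : E) :
    ‖x‖ ^ 2 / G ≤ inner ℝ x (P x) := by
  have h1 := hnonneg (P x - (1 / G) • x)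
  rw [map_sub, map_smul, hFP, inner_sub_left, inner_sub_right, inner_sub_right, inner_smul_left,
    inner_smul_left, inner_smul_right, inner_smul_right, hsymm x (P x), hFP,
    real_inner_self_eq_norm_sq] at h1
  have h2 : 1 / G * (1 / G * inner ℝ (F x) x) ≤ ‖x‖ ^ 2 / G := by
    have := mul_le_mul_of_nonneg_left (hup x) (show 0 ≤ 1 / G * (1 / G) by positivity)
    calc _ = 1 / G * (1 / G) * inner ℝ (F x) x := by ring
      _ ≤ _ := this
      _ = _ := by field_simp
  simp only [RCLike.conj_to_real] at h1
  have h3 : 1 / G * ‖x‖ ^ 2 = ‖x‖ ^ 2 / G := by ring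
  linarith

/-- Polarization, `2⟨x, P y⟩ = ⟨x, P x⟩ + ⟨y, P y⟩ - ⟨x - y, P (x - y)⟩`, with `P` between `1/G` and
`1/μ`. The term in `‖y‖²` later absorbs the cost of the movement of the iterates. -/
theorem inner_inverse_apply_ge (hFP : ∀ x, F (P x) = x)
    (hsymm : ∀ x y, inner ℝ (F x) y = inner ℝ x (F y)) (hμ : 0 < μ)
    (hlow : ∀ x, μ * ‖x‖ ^ 2 ≤ inner ℝ (F x) x)
    (hup : ∀ x, inner ℝ (F x) x ≤ G * ‖x‖ ^ 2) (hG : 0 < G) (x y : E) :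
    (‖x‖ ^ 2 + ‖y‖ ^ 2) / (2 * G) - ‖x - y‖ ^ 2 / (2 * μ) ≤ inner ℝ x (P y) := by
  have hnn : ∀ x, 0 ≤ inner ℝ (F x) x := fun x => le_trans (by positivity) (hlow x)
  have hPsymm : inner ℝ y (P x) = inner ℝ x (P y) := by
    have := hsymm (P x) (P y)
    rw [hFP, hFP] at this
    rw [this, real_inner_comm]
  have h1 := inner_inverse_apply_self_ge hFP hsymm hnn hup hG x
  have h2 := inner_inverse_apply_self_ge hFP hsymm hnn hup hG y
  have h3 : inner ℝ (x - y) (P (x - y)) ≤ ‖x - y‖ ^ 2 / μ := by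
    refine (real_inner_le_norm _ _).trans ?_
    refine (mul_le_mul_of_nonneg_left (norm_inverse_apply_le hFP hμ hlow (x - y))
      (norm_nonneg _)).trans (le_of_eq ?_)
    ring
  rw [map_sub, inner_sub_left, inner_sub_right, inner_sub_right, hPsymm] at h3
  have h4 : (‖x‖ ^ 2 + ‖y‖ ^ 2) / (2 * G) - ‖x - y‖ ^ 2 / (2 * μ) =
    (‖x‖ ^ 2 / G + ‖y‖ ^ 2 / G - ‖x - y‖ ^ 2 / μ) / 2 := by
    field_simp
  rw [h4]
  linarith

end Inverse

/-! ### Spectral bounds of the Fisher matrix -/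

namespace Model

variable {n d : ℕ} {S : Fin n → Type u} {A : Type v} [∀ i, Fintype (S i)] [Fintype A]
  (𝓜 : Model n d S A)

theorem fisher_apply (i : Fin n) (θ x : Param d) :
    Matrix.toEuclideanLin (𝓜.fisher i θ) x = ∑ τ, 𝓜.trajProb i θ τ • (1 / (𝓜.H : ℝ)) •
      ∑ h : Fin 𝓜.H, inner ℝ (𝓜.score i (τ.1 h.castSucc) (τ.2 h) θ) x •
        𝓜.score i (τ.1 h.castSucc) (τ.2 h) θ := by
  have hv : ∀ a : Param d, Matrix.toEuclideanLin (Matrix.vecMulVec a.ofLp a.ofLp) x =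
      inner ℝ a x • a := by
    intro a
    ext k
    simp [Matrix.toLpLin_apply, Matrix.vecMulVec_mulVec, PiLp.inner_apply, dotProduct, mul_comm]
  rw [fisher, trajExp, map_sum, LinearMap.sum_apply]
  refine Finset.sum_congr rfl fun τ _ => ?_
  rw [map_smul, map_smul, map_sum, LinearMap.smul_apply, LinearMap.smul_apply,
    LinearMap.sum_apply]
  simp only [hv]

theorem inner_fisher_apply (i : Fin n) (θ x y : Param d) :
    inner ℝ (Matrix.toEuclideanLin (𝓜.fisher i θ) x) y =
      ∑ τ, 𝓜.trajProb i θ τ * ((1 / (𝓜.H : ℝ)) *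
      ∑ h : Fin 𝓜.H, inner ℝ (𝓜.score i (τ.1 h.castSucc) (τ.2 h) θ) x *
        inner ℝ (𝓜.score i (τ.1 h.castSucc) (τ.2 h) θ) y) := by
  rw [fisher_apply, sum_inner]
  simp only [inner_smul_left, sum_inner, RCLike.conj_to_real]

theorem inner_fisher_symm (i : Fin n) (θ x y : Param d) :
    inner ℝ (Matrix.toEuclideanLin (𝓜.fisher i θ) x) y =
      inner ℝ x (Matrix.toEuclideanLin (𝓜.fisher i θ) y) := by
  rw [real_inner_comm _ x, inner_fisher_apply, inner_fisher_apply]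
  simp only [mul_comm]

variable {𝓜} {G M μF : ℝ}

theorem LogPolicyBounded.inner_fisher_le (hlog : 𝓜.LogPolicyBounded G M) (i : Fin n)
    (θ x : Param d) :
    inner ℝ (Matrix.toEuclideanLin (𝓜.fisher i θ) x) x ≤ G * ‖x‖ ^ 2 := by
  have hH : (0 : ℝ) < 𝓜.H := Nat.cast_pos.2 𝓜.H_pos
  rw [inner_fisher_apply]
  calc _ ≤ ∑ τ, 𝓜.trajProb i θ τ * (G * ‖x‖ ^ 2) := by
        refine Finset.sum_le_sum fun τ _ =>
          mul_le_mul_of_nonneg_left ?_ (𝓜.trajProb_nonneg i θ τ)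
        rw [div_mul_eq_mul_div, one_mul, div_le_iff₀ hH]
        refine (Finset.sum_le_sum (g := fun _ => G * ‖x‖ ^ 2) fun h _ => ?_).trans ?_
        · rw [← sq, ← sq_abs]
          refine (pow_le_pow_left₀ (abs_nonneg _) (abs_real_inner_le_norm _ _) 2).trans ?_
          rw [mul_pow]
          exact mul_le_mul_of_nonneg_right (hlog.score_le θ i _ _) (sq_nonneg _)
        · simp [mul_comm]
    _ = _ := by rw [← Finset.sum_mul, sum_trajProb, one_mul]

theorem FisherLowerBound.inner_fisher_ge (hF : 𝓜.FisherLowerBound μF) (i : Fin n)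
    (θ x : Param d) :
    μF * ‖x‖ ^ 2 ≤ inner ℝ (Matrix.toEuclideanLin (𝓜.fisher i θ) x) x := by
  have h := (hF i θ).dotProduct_mulVec_nonneg x.ofLp
  have h1 : inner ℝ (Matrix.toEuclideanLin (𝓜.fisher i θ) x) x =
      x.ofLp ⬝ᵥ (𝓜.fisher i θ).mulVec x.ofLp := by
    simp [Matrix.toLpLin_apply, PiLp.inner_apply, dotProduct]
  have h2 : ‖x‖ ^ 2 = x.ofLp ⬝ᵥ x.ofLp := by
    rw [EuclideanSpace.real_norm_sq_eq]
    simp [dotProduct, sq]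
  simp only [star_trivial, Matrix.sub_mulVec, Matrix.smul_mulVec, Matrix.one_mulVec,
    dotProduct_sub, dotProduct_smul, smul_eq_mul] at h
  rw [h1, h2]
  linarith

theorem FisherLowerBound.fisher_inv_apply (hF : 𝓜.FisherLowerBound μF) (hμ : 0 < μF) (i : Fin n)
    (θ x : Param d) :
    Matrix.toEuclideanLin (𝓜.fisher i θ) (Matrix.toEuclideanLin (𝓜.fisher i θ)⁻¹ x) = x := by
  have hpd : (𝓜.fisher i θ).PosDef := by
    have h1 : (μF • (1 : Matrix (Fin d) (Fin d) ℝ)).PosDef := Matrix.PosDef.one.smul hμ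
    have := Matrix.PosDef.posSemidef_add (hF i θ) h1
    simpa using this
  have hu : IsUnit (𝓜.fisher i θ).det := (Matrix.isUnit_iff_isUnit_det _).1 hpd.isUnit
  simp [Matrix.toLpLin_apply, Matrix.mulVec_mulVec, Matrix.mul_nonsing_inv _ hu]

/-- Both spectral bounds are tested on a unit vector, which exists only if `d > 0`. -/
theorem FisherLowerBound.le_of_pos (hF : 𝓜.FisherLowerBound μF) (hlog : 𝓜.LogPolicyBounded G M)
    (i : Fin n) (hd : 0 < d) : μF ≤ G := by
  have h := (hF.inner_fisher_ge i 0 (EuclideanSpace.single ⟨0, hd⟩ 1)).trans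
    (hlog.inner_fisher_le i 0 _)
  simpa using h

end Model

/-! ### Averages and mixing -/

section Mixing

variable {n d : ℕ}

/-- The average over the agents. -/
def avg (x : Fin n → Param d) : Param d := (1 / (n : ℝ)) • ∑ i, x i

/-- The consensus error `∑ ‖x_i - x̄‖²`. -/
def dev (x : Fin n → Param d) : ℝ := ∑ i, ‖x i - avg x‖ ^ 2

theorem dev_nonneg (x : Fin n → Param d) : 0 ≤ dev x := Finset.sum_nonneg fun _ _ => sq_nonneg _

theorem smul_avg (hn : 0 < n) (x : Fin n → Param d) : (n : ℝ) • avg x = ∑ i, x i := by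
  have : (n : ℝ) ≠ 0 := by positivity
  rw [avg, smul_smul, mul_one_div_cancel this, one_smul]

theorem avg_add (x y : Fin n → Param d) : avg (fun i => x i + y i) = avg x + avg y := by
  simp only [avg, Finset.sum_add_distrib, smul_add]

theorem avg_sub (x y : Fin n → Param d) : avg (fun i => x i - y i) = avg x - avg y := by
  simp only [avg, Finset.sum_sub_distrib, smul_sub]

theorem avg_smul (c : ℝ) (x : Fin n → Param d) : avg (fun i => c • x i) = c • avg x := by
  simp only [avg, ← Finset.smul_sum, smul_comm c]

theorem avg_const (hn : 0 < n) (c : Param d) : avg (fun _ : Fin n => c) = c := by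
  have : (n : ℝ) ≠ 0 := by positivity
  simp [avg, ← Nat.cast_smul_eq_nsmul ℝ, smul_smul, this]

theorem sum_norm_sub_sq_eq (hn : 0 < n) (x : Fin n → Param d) (a : Param d) :
    ∑ i, ‖x i - a‖ ^ 2 = dev x + n * ‖avg x - a‖ ^ 2 := by
  have h : ∀ i, ‖x i - a‖ ^ 2 =
      ‖x i - avg x‖ ^ 2 + 2 * inner ℝ (x i - avg x) (avg x - a) + ‖avg x - a‖ ^ 2 := by
    intro i
    rw [← norm_add_sq_real]
    congr 2
    abel
  have h0 : ∑ i, (x i - avg x) = 0 := by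
    rw [Finset.sum_sub_distrib, ← smul_avg hn]
    simp [← Nat.cast_smul_eq_nsmul ℝ]
  simp only [h, Finset.sum_add_distrib, ← Finset.mul_sum, ← sum_inner, h0, dev]
  simp

theorem sum_norm_sq_eq (hn : 0 < n) (x : Fin n → Param d) :
    ∑ i, ‖x i‖ ^ 2 = dev x + n * ‖avg x‖ ^ 2 := by
  simpa using sum_norm_sub_sq_eq hn x 0

theorem dev_le (hn : 0 < n) (x : Fin n → Param d) (a : Param d) :
    dev x ≤ ∑ i, ‖x i - a‖ ^ 2 := by
  rw [sum_norm_sub_sq_eq hn x a]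
  exact le_add_of_nonneg_right (by positivity)

theorem dev_le_sum_norm_sq (hn : 0 < n) (x : Fin n → Param d) : dev x ≤ ∑ i, ‖x i‖ ^ 2 := by
  simpa using dev_le hn x 0

theorem mul_norm_avg_sq_le (hn : 0 < n) (x : Fin n → Param d) :
    n * ‖avg x‖ ^ 2 ≤ ∑ i, ‖x i‖ ^ 2 := by
  rw [sum_norm_sq_eq hn x]
  exact le_add_of_nonneg_left (dev_nonneg x)

variable {𝒢 : SimpleGraph (Fin n)} {W : Matrix (Fin n) (Fin n) ℝ}

theorem IsMixing.mix_apply (h : IsMixing 𝒢 W) (x : Fin n → Param d) (i : Fin n) :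
    mix 𝒢 W x i = ∑ j, W i j • x j := by
  refine Finset.sum_subset (Finset.subset_univ _) fun j _ hj => ?_
  simp only [nbhd, Finset.mem_filter, Finset.mem_univ, true_and, not_or] at hj
  rw [h.zero_of_not_adj i j hj.2 hj.1, zero_smul]

theorem IsMixing.avg_mix (h : IsMixing 𝒢 W) (x : Fin n → Param d) :
    avg (mix 𝒢 W x) = avg x := by
  simp only [avg, h.mix_apply]
  rw [Finset.sum_comm]
  simp only [← Finset.sum_smul, h.col_sum, one_smul]

/-- `W - (1/n) 1 1ᵀ` annihilates constants, so it acts on the deviations; the spectral norm, defined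
on scalars, is applied to each of the `d` coordinates separately. -/
theorem IsMixing.dev_mix_le (hn : 0 < n) (h : IsMixing 𝒢 W) (x : Fin n → Param d) :
    dev (mix 𝒢 W x) ≤ mixRate W ^ 2 * dev x := by
  have hn' : (n : ℝ) ≠ 0 := by positivity
  set B : Matrix (Fin n) (Fin n) ℝ := W - Matrix.of fun _ _ => 1 / (n : ℝ) with hB
  have hsub : ∀ i, mix 𝒢 W x i - avg x = ∑ j, B i j • (x j - avg x) := by
    intro i
    have h1 : ∑ j, B i j = 0 := by simp [hB, h.row_sum, hn']
    simp only [smul_sub, Finset.sum_sub_distrib]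
    rw [← Finset.sum_smul, h1, zero_smul, sub_zero, h.mix_apply, avg, Finset.smul_sum,
      ← Finset.sum_sub_distrib]
    refine Finset.sum_congr rfl fun j _ => ?_
    simp [hB, sub_smul]
  let w : Fin d → EuclideanSpace ℝ (Fin n) := fun k => WithLp.toLp 2 fun j => (x j - avg x) k
  have hcoord : ∀ k i, (mix 𝒢 W x i - avg x) k =
      Matrix.toEuclideanCLM (n := Fin n) (𝕜 := ℝ) B (w k) i := by
    intro k i
    rw [hsub]
    simp [w, Matrix.mulVec, dotProduct]
  rw [dev, h.avg_mix, dev]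
  simp only [EuclideanSpace.real_norm_sq_eq (n := Fin d), hcoord]
  rw [Finset.sum_comm, Finset.sum_comm (γ := Fin n), Finset.mul_sum]
  refine Finset.sum_le_sum fun k _ => ?_
  have h2 := (Matrix.toEuclideanCLM (n := Fin n) (𝕜 := ℝ) B).le_opNorm (w k)
  have h3 := pow_le_pow_left₀ (norm_nonneg _) h2 2
  rw [mul_pow, EuclideanSpace.real_norm_sq_eq, EuclideanSpace.real_norm_sq_eq] at h3
  exact h3

theorem IsMixing.dev_mix_add_le (hn : 0 < n) (h : IsMixing 𝒢 W) (hρ : mixRate W ^ 2 < 1)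
    (x y : Fin n → Param d) :
    dev (mix 𝒢 W fun i => x i + y i) ≤ (1 + mixRate W ^ 2) / 2 * dev x +
      2 * mixRate W ^ 2 / (1 - mixRate W ^ 2) * ∑ i, ‖y i‖ ^ 2 := by
  set r := mixRate W ^ 2 with hr
  have hr0 : 0 ≤ r := sq_nonneg _
  have hq : 0 < 1 - r := by linarith
  -- Young's inequality, weighted so that the factor `r` on `a²` relaxes only to the midpoint of `r`
  -- and `1`. The price on `b²` still carries `r`.
  have hscalar : ∀ a b : ℝ, r * (a + b) ^ 2 ≤ (1 + r) / 2 * a ^ 2 + 2 * r / (1 - r) * b ^ 2 := by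
    intro a b
    have h1 : (1 + r) / 2 * a ^ 2 + 2 * r / (1 - r) * b ^ 2 - r * (a + b) ^ 2 =
        (1 - r) / 2 * (a - 2 * r / (1 - r) * b) ^ 2 + r * b ^ 2 := by
      field_simp
      ring
    have h2 : 0 ≤ (1 - r) / 2 * (a - 2 * r / (1 - r) * b) ^ 2 + r * b ^ 2 := by positivity
    linarith
  refine (h.dev_mix_le hn _).trans ?_
  have h1 : r * dev (fun i => x i + y i) ≤ (1 + r) / 2 * dev x + 2 * r / (1 - r) * dev y := by
    simp only [dev, Finset.mul_sum, ← Finset.sum_add_distrib, avg_add]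
    refine Finset.sum_le_sum fun i _ => ?_
    refine le_trans ?_ (hscalar ‖x i - avg x‖ ‖y i - avg y‖)
    have h2 : x i + y i - (avg x + avg y) = (x i - avg x) + (y i - avg y) := by abel
    rw [h2]
    gcongr
    exact norm_add_le _ _
  refine h1.trans ?_
  gcongr
  exact dev_le_sum_norm_sq hn y

end Mixing

section

theorem sum_mul_norm_add_sq {E : Type*} [NormedAddCommGroup E] [InnerProductSpace ℝ E]
    {Y : Type*} [Fintype Y] {p : Y → ℝ} (hp : ∑ x, p x = 1) (a : E) {ξ : Y → E}
    (hξ : ∑ x, p x • ξ x = 0) :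
    ∑ x, p x * ‖a + ξ x‖ ^ 2 = ‖a‖ ^ 2 + ∑ x, p x * ‖ξ x‖ ^ 2 := by
  have h : ∀ x, p x * ‖a + ξ x‖ ^ 2 =
      p x * ‖a‖ ^ 2 + 2 * inner ℝ a (p x • ξ x) + p x * ‖ξ x‖ ^ 2 := by
    intro x
    rw [norm_add_sq_real, inner_smul_right]
    ring
  simp only [h, Finset.sum_add_distrib, ← Finset.mul_sum, ← Finset.sum_mul, hp, ← inner_sum, hξ]
  simp

theorem norm_add_sq_le_two_mul {E : Type*} [SeminormedAddCommGroup E] (a b : E) :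
    ‖a + b‖ ^ 2 ≤ 2 * ‖a‖ ^ 2 + 2 * ‖b‖ ^ 2 := by
  have h := pow_le_pow_left₀ (norm_nonneg _) (norm_add_le a b) 2
  linarith [add_sq_le (a := ‖a‖) (b := ‖b‖)]

theorem norm_sub_sq_le_two_mul {E : Type*} [SeminormedAddCommGroup E] (a b : E) :
    ‖a - b‖ ^ 2 ≤ 2 * ‖a‖ ^ 2 + 2 * ‖b‖ ^ 2 := by
  simpa [sub_eq_add_neg] using norm_add_sq_le_two_mul a (-b)

variable {n d : ℕ} {S : Fin n → Type u} {A : Type v} [∀ i, Fintype (S i)] [Fintype A]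
  (𝓜 : Model n d S A) (I : Input n d)

/-! ### Expectations along a run -/

/-- The conditional expectation of `φ` after the next round. -/
def stepExp (φ : State n d → ℝ) (s : State n d) : ℝ :=
  ∑ τ : ∀ i, 𝓜.AgentTraj i, (∏ i, 𝓜.trajProb i (s.θnext i) (τ i)) * φ (step 𝓜 I s τ)

/-- The expectation over the initial mini-batches. -/
def batchExp (φ : State n d → ℝ) : ℝ :=
  ∑ τ₀ : ∀ i, Fin I.B → 𝓜.AgentTraj i,
    (∏ i, ∏ b, 𝓜.trajProb i I.θ₀ (τ₀ i b)) * φ (initState 𝓜 I τ₀)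

/-- The expectation of a function of the variables after round `t`. -/
def runExp (t : ℕ) (φ : State n d → ℝ) : ℝ :=
  ∑ ω : SamplePath 𝓜 I, pathProb 𝓜 I ω * φ (run 𝓜 I ω t)

theorem run_eq_iterStep (ω : SamplePath 𝓜 I) (t : ℕ) :
    run 𝓜 I ω t = iterStep (step 𝓜 I) (initState 𝓜 I ω.1) ω.2 t := by
  induction t with
  | zero => rfl
  | succ t ih => rw [run, iterStep, ih]

theorem sum_prod_trajProb (θ : Fin n → Param d) :
    ∑ τ : ∀ i, 𝓜.AgentTraj i, ∏ i, 𝓜.trajProb i (θ i) (τ i) = 1 :=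
  sum_pi_prod_eq_one (p := fun i => 𝓜.trajProb i (θ i)) fun i => 𝓜.sum_trajProb i (θ i)

theorem sum_prod_trajProb_batch (i : Fin n) (B : ℕ) (θ : Param d) :
    ∑ τ : Fin B → 𝓜.AgentTraj i, ∏ b, 𝓜.trajProb i θ (τ b) = 1 :=
  sum_pi_prod_eq_one (p := fun _ => 𝓜.trajProb i θ) fun _ => 𝓜.sum_trajProb i θ

/-- Given the mini-batches, a run is a Markov process: the law of the next trajectories depends only
on `θnext` of the current state. -/
theorem runExp_eq (t : ℕ) (φ : State n d → ℝ) :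
    runExp 𝓜 I t φ = ∑ τ₀ : ∀ i, Fin I.B → 𝓜.AgentTraj i,
      (∏ i, ∏ b, 𝓜.trajProb i I.θ₀ (τ₀ i b)) *
        procExp (step 𝓜 I) (fun s τ => ∏ i, 𝓜.trajProb i (s.θnext i) (τ i)) I.T
          (initState 𝓜 I τ₀) t φ := by
  rw [runExp, Fintype.sum_prod_type]
  refine Finset.sum_congr rfl fun τ₀ _ => ?_
  rw [procExp, Finset.mul_sum]
  refine Finset.sum_congr rfl fun ω _ => ?_
  simp only [pathProb, run_eq_iterStep, mul_assoc]

theorem runExp_zero (φ : State n d → ℝ) : runExp 𝓜 I 0 φ = batchExp 𝓜 I φ := by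
  rw [runExp_eq]
  simp only [procExp_zero (fun s : State n d => sum_prod_trajProb 𝓜 s.θnext)]
  rfl

theorem runExp_succ {t : ℕ} (ht : t < I.T) (φ : State n d → ℝ) :
    runExp 𝓜 I (t + 1) φ = runExp 𝓜 I t (stepExp 𝓜 I φ) := by
  rw [runExp_eq, runExp_eq]
  simp only [procExp_succ (fun s : State n d => sum_prod_trajProb 𝓜 s.θnext) ht]
  rfl

theorem runExp_one {t : ℕ} (ht : t ≤ I.T) : runExp 𝓜 I t (fun _ => 1) = 1 := by
  induction t with
  | zero =>
    rw [runExp_zero, batchExp]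
    simp only [mul_one]
    exact sum_pi_prod_eq_one (p := fun i (x : Fin I.B → 𝓜.AgentTraj i) =>
      ∏ b, 𝓜.trajProb i I.θ₀ (x b)) fun i => sum_prod_trajProb_batch 𝓜 i I.B I.θ₀
  | succ t ih =>
    have h : stepExp 𝓜 I (fun _ => 1) = fun _ => 1 := by
      ext s
      simp only [stepExp, mul_one]
      exact sum_prod_trajProb 𝓜 s.θnext
    rw [runExp_succ 𝓜 I ht, h, ih (by omega)]

theorem runExp_add (t : ℕ) (φ ψ : State n d → ℝ) :
    runExp 𝓜 I t (fun s => φ s + ψ s) = runExp 𝓜 I t φ + runExp 𝓜 I t ψ := by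
  simp only [runExp, mul_add, Finset.sum_add_distrib]

theorem runExp_mul_left (t : ℕ) (c : ℝ) (φ : State n d → ℝ) :
    runExp 𝓜 I t (fun s => c * φ s) = c * runExp 𝓜 I t φ := by
  simp only [runExp, Finset.mul_sum, mul_left_comm]

theorem runExp_const {t : ℕ} (ht : t ≤ I.T) (c : ℝ) : runExp 𝓜 I t (fun _ => c) = c := by
  have := runExp_mul_left 𝓜 I t c (fun _ => 1)
  rw [runExp_one 𝓜 I ht] at this
  simpa using this

theorem pathProb_nonneg (ω : SamplePath 𝓜 I) : 0 ≤ pathProb 𝓜 I ω :=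
  mul_nonneg (Finset.prod_nonneg fun _ _ => Finset.prod_nonneg fun _ _ => 𝓜.trajProb_nonneg _ _ _)
    (Finset.prod_nonneg fun _ _ => Finset.prod_nonneg fun _ _ => 𝓜.trajProb_nonneg _ _ _)

/-- The tracking property and the parameter update, which hold along every run. -/
structure Consistent (s : State n d) : Prop where
  avg_y : avg s.y = avg s.v
  θnext_eq : s.θnext = paramUpdate 𝓜 I s.θ s.y

variable {𝓜 I} in
theorem IsMixing.consistent_initState (hW : IsMixing I.𝒢 I.W)
    (τ₀ : ∀ i, Fin I.B → 𝓜.AgentTraj i) : Consistent 𝓜 I (initState 𝓜 I τ₀) :=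
  ⟨hW.avg_mix _, rfl⟩

variable {𝓜 I} in
theorem IsMixing.consistent_step (hW : IsMixing I.𝒢 I.W) {s : State n d}
    (hs : Consistent 𝓜 I s) (τ : ∀ i, 𝓜.AgentTraj i) : Consistent 𝓜 I (step 𝓜 I s τ) := by
  refine ⟨?_, rfl⟩
  refine (hW.avg_mix _).trans ?_
  rw [avg_sub, avg_add, hs.avg_y]
  simp only [add_sub_cancel_left]
  rfl

theorem IsMixing.consistent_run (hW : IsMixing I.𝒢 I.W) (ω : SamplePath 𝓜 I) (t : ℕ) :
    Consistent 𝓜 I (run 𝓜 I ω t) := by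
  induction t with
  | zero => exact hW.consistent_initState ω.1
  | succ t ih =>
    rw [run]
    split_ifs with h
    · exact hW.consistent_step ih _
    · exact ih

theorem IsMixing.runExp_mono (hW : IsMixing I.𝒢 I.W) (t : ℕ) {φ ψ : State n d → ℝ}
    (h : ∀ s, Consistent 𝓜 I s → φ s ≤ ψ s) : runExp 𝓜 I t φ ≤ runExp 𝓜 I t ψ :=
  Finset.sum_le_sum fun ω _ =>
    mul_le_mul_of_nonneg_left (h _ (hW.consistent_run 𝓜 I ω t)) (pathProb_nonneg 𝓜 I ω)

theorem stepExp_mono {s : State n d} {φ ψ : State n d → ℝ}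
    (h : ∀ τ, φ (step 𝓜 I s τ) ≤ ψ (step 𝓜 I s τ)) : stepExp 𝓜 I φ s ≤ stepExp 𝓜 I ψ s :=
  Finset.sum_le_sum fun τ _ => mul_le_mul_of_nonneg_left (h τ)
    (Finset.prod_nonneg fun _ _ => 𝓜.trajProb_nonneg _ _ _)

theorem expOut_eq (f : Param d → ℝ) :
    expOut 𝓜 I f = 1 / ((n : ℝ) * ((I.T : ℝ) + 1)) *
      ∑ t ∈ Finset.range (I.T + 1), runExp 𝓜 I t (fun s => ∑ i, f (s.θ i)) := by
  rw [← Fin.sum_univ_eq_sum_range (fun t => runExp 𝓜 I t (fun s => ∑ i, f (s.θ i))), expOut,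
    Fintype.sum_prod_type, Finset.mul_sum]
  simp only [runExp, Finset.mul_sum]
  conv_rhs => rw [Finset.sum_comm]
  refine Finset.sum_congr rfl fun ω _ => ?_
  rw [Fintype.sum_prod_type, Finset.sum_comm]
  refine Finset.sum_congr rfl fun t _ => Finset.sum_congr rfl fun i _ => ?_
  rw [outcomeProb, thetaOut]
  ring

/-! ### One round of the variance-reduced estimators -/

/-- The errors `v_i - ∇V_i(θ_i)` of the gradient estimators. -/
def gradErr (s : State n d) (i : Fin n) : Param d :=
  s.v i - gradient (𝓜.localValue i) (s.θ i)

/-- The noise of agent `i` in one round, with parameters `θ'`, `θ` before and after the update. -/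
def stepNoise (β : ℝ) (i : Fin n) (θ' θ : Param d) (τ : 𝓜.AgentTraj i) : Param d :=
  β • (𝓜.gradEst i τ θ - gradient (𝓜.localValue i) θ) +
    (1 - β) • (𝓜.gradEst i τ θ - 𝓜.impWeight i τ θ' θ • 𝓜.gradEst i τ θ' -
      (gradient (𝓜.localValue i) θ - gradient (𝓜.localValue i) θ'))

/-- The estimator is affine in its past, so the old error enters with the factor `1 - β` and
everything random is collected in the noise. -/
theorem gradErr_step (s : State n d) (τ : ∀ i, 𝓜.AgentTraj i) (i : Fin n) :
    gradErr 𝓜 (step 𝓜 I s τ) i = (1 - I.β) • gradErr 𝓜 s i +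
      stepNoise 𝓜 I.β i (s.θ i) (s.θnext i) (τ i) := by
  simp only [gradErr, stepNoise, step]
  module

theorem v_step_sub (s : State n d) (τ : ∀ i, 𝓜.AgentTraj i) (i : Fin n) :
    (step 𝓜 I s τ).v i - s.v i = (-I.β) • gradErr 𝓜 s i +
      (gradient (𝓜.localValue i) (s.θnext i) - gradient (𝓜.localValue i) (s.θ i)) +
      stepNoise 𝓜 I.β i (s.θ i) (s.θnext i) (τ i) := by
  simp only [gradErr, stepNoise, step]
  module

variable {𝓜 I} {G M Wv : ℝ} {ν : Fin n → ℝ}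

theorem Model.LogPolicyBounded.sum_trajProb_smul_stepNoise (hlog : 𝓜.LogPolicyBounded G M)
    (β : ℝ) (i : Fin n) (θ' θ : Param d) :
    ∑ τ, 𝓜.trajProb i θ τ • stepNoise 𝓜 β i θ' θ τ = 0 := by
  have h : ∀ τ, 𝓜.trajProb i θ τ • stepNoise 𝓜 β i θ' θ τ =
      𝓜.trajProb i θ τ • 𝓜.gradEst i τ θ -
        𝓜.trajProb i θ τ • gradient (𝓜.localValue i) θ -
      (1 - β) • (𝓜.trajProb i θ τ • 𝓜.impWeight i τ θ' θ • 𝓜.gradEst i τ θ' -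
        𝓜.trajProb i θ τ • gradient (𝓜.localValue i) θ') := by
    intro τ
    rw [stepNoise]
    module
  simp only [h, Finset.sum_sub_distrib, ← Finset.smul_sum, ← Finset.sum_smul,
    hlog.sum_trajProb_smul_impWeight_smul_gradEst, ← hlog.gradient_localValue,
    Model.sum_trajProb, one_smul, sub_self, smul_zero]

/-- The second half of the noise is a centred version of `g(θ) - ω g(θ')`, and centring only lowers
the second moment. The factor 4 comes from `‖a + b‖² ≤ 2‖a‖² + 2‖b‖²` applied twice. -/
theorem Model.LogPolicyBounded.sum_trajProb_mul_norm_stepNoise_sq_le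
    (hlog : 𝓜.LogPolicyBounded G M) (himp : 𝓜.ImpWeightVarBounded Wv)
    (hvar : 𝓜.GradEstVarBounded ν) {β : ℝ} (hβ0 : 0 ≤ β) (hβ1 : β ≤ 1) (i : Fin n)
    (θ' θ : Param d) :
    ∑ τ, 𝓜.trajProb i θ τ * ‖stepNoise 𝓜 β i θ' θ τ‖ ^ 2 ≤
      2 * β ^ 2 * ν i ^ 2 + 4 * 𝓜.constΦSq G M Wv * ‖θ - θ'‖ ^ 2 := by
  have hΔ := hlog.sum_trajProb_mul_norm_gradEst_sub_sq_le himp i θ' θ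
  have hmean : ∑ τ, 𝓜.trajProb i θ τ •
      (𝓜.gradEst i τ θ - 𝓜.impWeight i τ θ' θ • 𝓜.gradEst i τ θ') =
      gradient (𝓜.localValue i) θ - gradient (𝓜.localValue i) θ' := by
    simp only [smul_sub, Finset.sum_sub_distrib, hlog.sum_trajProb_smul_impWeight_smul_gradEst,
      ← hlog.gradient_localValue]
  have h1 := (sum_norm_sub_mean_sq_le (𝓜.sum_trajProb i θ) _ hmean).trans hΔ
  have h2 := hvar i θ
  simp only [Model.trajExp, smul_eq_mul] at h2
  have h3 : ∀ τ, 𝓜.trajProb i θ τ * ‖stepNoise 𝓜 β i θ' θ τ‖ ^ 2 ≤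
      2 * β ^ 2 * (𝓜.trajProb i θ τ * ‖𝓜.gradEst i τ θ - gradient (𝓜.localValue i) θ‖ ^ 2) +
      2 * (𝓜.trajProb i θ τ *
        ‖𝓜.gradEst i τ θ - 𝓜.impWeight i τ θ' θ • 𝓜.gradEst i τ θ' -
          (gradient (𝓜.localValue i) θ - gradient (𝓜.localValue i) θ')‖ ^ 2) := by
    intro τ
    have h4 := norm_add_sq_le_two_mul (β • (𝓜.gradEst i τ θ - gradient (𝓜.localValue i) θ))
      ((1 - β) • (𝓜.gradEst i τ θ - 𝓜.impWeight i τ θ' θ • 𝓜.gradEst i τ θ' -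
        (gradient (𝓜.localValue i) θ - gradient (𝓜.localValue i) θ')))
    rw [← stepNoise, norm_smul, norm_smul, mul_pow, mul_pow, Real.norm_eq_abs, Real.norm_eq_abs,
      sq_abs, sq_abs] at h4
    have h5 : (1 - β) ^ 2 ≤ 1 := by nlinarith
    have h6 := mul_le_mul_of_nonneg_right h5 (sq_nonneg
      ‖𝓜.gradEst i τ θ - 𝓜.impWeight i τ θ' θ • 𝓜.gradEst i τ θ' -
        (gradient (𝓜.localValue i) θ - gradient (𝓜.localValue i) θ')‖)
    rw [one_mul] at h6
    have h7 := mul_le_mul_of_nonneg_left (h4.trans (add_le_add_right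
      (mul_le_mul_of_nonneg_left h6 zero_le_two) _)) (𝓜.trajProb_nonneg i θ τ)
    refine h7.trans (le_of_eq ?_)
    ring
  refine (Finset.sum_le_sum fun τ _ => h3 τ).trans ?_
  rw [Finset.sum_add_distrib, ← Finset.mul_sum, ← Finset.mul_sum]
  have h7 := mul_le_mul_of_nonneg_left h2 (show 0 ≤ 2 * β ^ 2 by positivity)
  linarith

/-- `∑ ‖θ_i^{t+1} - θ_i^t‖²`. -/
def moveSq (s : State n d) : ℝ := ∑ i, ‖s.θnext i - s.θ i‖ ^ 2

section OneRound

variable (hlog : 𝓜.LogPolicyBounded G M) (himp : 𝓜.ImpWeightVarBounded Wv)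
  (hvar : 𝓜.GradEstVarBounded ν) (hβ0 : 0 ≤ I.β) (hβ1 : I.β ≤ 1)
include hlog himp hvar hβ0 hβ1

theorem sum_noise_le (s : State n d) :
    ∑ i, ∑ τ, 𝓜.trajProb i (s.θnext i) τ *
      ‖stepNoise 𝓜 I.β i (s.θ i) (s.θnext i) τ‖ ^ 2 ≤
      2 * I.β ^ 2 * ∑ i, ν i ^ 2 + 4 * 𝓜.constΦSq G M Wv * moveSq s := by
  rw [moveSq, Finset.mul_sum, Finset.mul_sum, ← Finset.sum_add_distrib]
  exact Finset.sum_le_sum fun i _ =>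
    hlog.sum_trajProb_mul_norm_stepNoise_sq_le himp hvar hβ0 hβ1 i _ _

/-- Independence of the agents removes the cross terms, so the averaged noise has `(1/n)²` times the
sum of the variances. The factor `(1 - β)²` is relaxed to `1 - β`. -/
theorem stepExp_avg_gradErr_le (s : State n d) :
    stepExp 𝓜 I (fun s => ‖avg (gradErr 𝓜 s)‖ ^ 2) s ≤
      (1 - I.β) * ‖avg (gradErr 𝓜 s)‖ ^ 2 +
      (1 / (n : ℝ)) ^ 2 * (2 * I.β ^ 2 * ∑ i, ν i ^ 2 + 4 * 𝓜.constΦSq G M Wv * moveSq s) := by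
  have h1 : ∀ τ : ∀ i, 𝓜.AgentTraj i, avg (gradErr 𝓜 (step 𝓜 I s τ)) =
      (1 - I.β) • avg (gradErr 𝓜 s) +
        ∑ i, (1 / (n : ℝ)) • stepNoise 𝓜 I.β i (s.θ i) (s.θnext i) (τ i) := by
    intro τ
    rw [← avg_smul, ← Finset.smul_sum, avg, avg, ← smul_add, ← Finset.sum_add_distrib]
    simp only [gradErr_step]
  simp only [stepExp, h1]
  have h2 := sum_pi_norm_add_sum_sq (p := fun i => 𝓜.trajProb i (s.θnext i))
    (fun i => 𝓜.sum_trajProb i _) ((1 - I.β) • avg (gradErr 𝓜 s))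
    (fun i τ => (1 / (n : ℝ)) • stepNoise 𝓜 I.β i (s.θ i) (s.θnext i) τ) fun i => by
      simp only [smul_comm _ (1 / (n : ℝ)), ← Finset.smul_sum,
        hlog.sum_trajProb_smul_stepNoise, smul_zero]
  rw [h2]
  simp only [norm_smul, mul_pow, Real.norm_eq_abs, sq_abs, mul_left_comm _ ((1 / (n : ℝ)) ^ 2),
    ← Finset.mul_sum]
  have h3 := mul_le_mul_of_nonneg_left (sum_noise_le hlog himp hvar hβ0 hβ1 s)
    (sq_nonneg (1 / (n : ℝ)))
  have h4 : (1 - I.β) ^ 2 ≤ 1 - I.β := by nlinarith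
  have h5 := mul_le_mul_of_nonneg_right h4 (sq_nonneg ‖avg (gradErr 𝓜 s)‖)
  linarith

/-- Serves both the estimation error and the increment of `v`: each is a quantity fixed by the past
plus the same centred noise. -/
theorem stepExp_sum_sq_le (s : State n d) (a : Fin n → Param d) (φ : State n d → Fin n → Param d)
    (hφ : ∀ τ i, φ (step 𝓜 I s τ) i =
      a i + stepNoise 𝓜 I.β i (s.θ i) (s.θnext i) (τ i)) :
    stepExp 𝓜 I (fun s => ∑ i, ‖φ s i‖ ^ 2) s ≤
      ∑ i, ‖a i‖ ^ 2 + (2 * I.β ^ 2 * ∑ i, ν i ^ 2 + 4 * 𝓜.constΦSq G M Wv * moveSq s) := by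
  refine le_trans (le_of_eq ?_) (add_le_add_right (sum_noise_le hlog himp hvar hβ0 hβ1 s) _)
  simp only [stepExp, hφ, Finset.mul_sum]
  rw [Finset.sum_comm, ← Finset.sum_add_distrib]
  refine Finset.sum_congr rfl fun i _ => ?_
  rw [sum_pi_coord_mul (p := fun i => 𝓜.trajProb i (s.θnext i)) (fun i => 𝓜.sum_trajProb i _) i
    (fun τ => ‖a i + stepNoise 𝓜 I.β i (s.θ i) (s.θnext i) τ‖ ^ 2)]
  exact sum_mul_norm_add_sq (𝓜.sum_trajProb i _) _ (hlog.sum_trajProb_smul_stepNoise _ i _ _)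

theorem stepExp_sum_gradErr_le (s : State n d) :
    stepExp 𝓜 I (fun s => ∑ i, ‖gradErr 𝓜 s i‖ ^ 2) s ≤
      (1 - I.β) * ∑ i, ‖gradErr 𝓜 s i‖ ^ 2 +
      (2 * I.β ^ 2 * ∑ i, ν i ^ 2 + 4 * 𝓜.constΦSq G M Wv * moveSq s) := by
  refine (stepExp_sum_sq_le hlog himp hvar hβ0 hβ1 s (fun i => (1 - I.β) • gradErr 𝓜 s i)
    (gradErr 𝓜) (gradErr_step 𝓜 I s)).trans (add_le_add_left ?_ _)
  simp only [norm_smul, mul_pow, Real.norm_eq_abs, sq_abs, ← Finset.mul_sum]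
  have h4 : (1 - I.β) ^ 2 ≤ 1 - I.β := by nlinarith
  exact mul_le_mul_of_nonneg_right h4 (Finset.sum_nonneg fun _ _ => sq_nonneg _)

/-- The tracker mixes `y` plus the increment of `v`, so the perturbed contraction applies. The
increment is `-β` times the old error, a gradient difference bounded through `L`, and noise. -/
theorem stepExp_dev_y_le (hn : 0 < n) (hW : IsMixing I.𝒢 I.W) (hρ : mixRate I.W ^ 2 < 1)
    (s : State n d) :
    stepExp 𝓜 I (fun s => dev s.y) s ≤ (1 + mixRate I.W ^ 2) / 2 * dev s.y +
      2 * mixRate I.W ^ 2 / (1 - mixRate I.W ^ 2) *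
        (2 * I.β ^ 2 * ∑ i, ‖gradErr 𝓜 s i‖ ^ 2 + 2 * 𝓜.constL G M ^ 2 * moveSq s +
          (2 * I.β ^ 2 * ∑ i, ν i ^ 2 + 4 * 𝓜.constΦSq G M Wv * moveSq s)) := by
  have hq : 0 < 1 - mixRate I.W ^ 2 := by linarith
  have h1 : ∀ τ, dev (step 𝓜 I s τ).y ≤ (1 + mixRate I.W ^ 2) / 2 * dev s.y +
      2 * mixRate I.W ^ 2 / (1 - mixRate I.W ^ 2) * ∑ i, ‖(step 𝓜 I s τ).v i - s.v i‖ ^ 2 := by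
    intro τ
    have h := hW.dev_mix_add_le hn hρ s.y fun i => (step 𝓜 I s τ).v i - s.v i
    refine le_trans (le_of_eq ?_) h
    simp only [add_sub]
    rfl
  refine (stepExp_mono 𝓜 I (ψ := fun s' => (1 + mixRate I.W ^ 2) / 2 * dev s.y +
      2 * mixRate I.W ^ 2 / (1 - mixRate I.W ^ 2) * ∑ i, ‖s'.v i - s.v i‖ ^ 2) h1).trans ?_
  have h2 := stepExp_sum_sq_le hlog himp hvar hβ0 hβ1 s (fun i => (-I.β) • gradErr 𝓜 s i +
      (gradient (𝓜.localValue i) (s.θnext i) - gradient (𝓜.localValue i) (s.θ i)))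
    (fun s' i => s'.v i - s.v i) (v_step_sub 𝓜 I s)
  have h3 : ∑ i, ‖(-I.β) • gradErr 𝓜 s i + (gradient (𝓜.localValue i) (s.θnext i) -
      gradient (𝓜.localValue i) (s.θ i))‖ ^ 2 ≤
      2 * I.β ^ 2 * ∑ i, ‖gradErr 𝓜 s i‖ ^ 2 + 2 * 𝓜.constL G M ^ 2 * moveSq s := by
    rw [moveSq, Finset.mul_sum, Finset.mul_sum, ← Finset.sum_add_distrib]
    refine Finset.sum_le_sum fun i _ => ?_
    refine (norm_add_sq_le_two_mul _ _).trans ?_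
    have h4 := pow_le_pow_left₀ (norm_nonneg _)
      (hlog.norm_gradient_localValue_sub_le i (s.θnext i) (s.θ i)) 2
    rw [norm_smul, mul_pow, Real.norm_eq_abs, sq_abs]
    linarith
  have h5 : stepExp 𝓜 I (fun s' => (1 + mixRate I.W ^ 2) / 2 * dev s.y +
      2 * mixRate I.W ^ 2 / (1 - mixRate I.W ^ 2) * ∑ i, ‖s'.v i - s.v i‖ ^ 2) s =
      (1 + mixRate I.W ^ 2) / 2 * dev s.y + 2 * mixRate I.W ^ 2 / (1 - mixRate I.W ^ 2) *
        stepExp 𝓜 I (fun s' => ∑ i, ‖s'.v i - s.v i‖ ^ 2) s := by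
    simp only [stepExp, mul_add, Finset.sum_add_distrib, ← Finset.sum_mul, sum_prod_trajProb,
      one_mul]
    congr 1
    rw [Finset.mul_sum]
    exact Finset.sum_congr rfl fun τ _ => mul_left_comm _ _ _
  rw [h5]
  gcongr
  linarith

end OneRound

/-! ### The initial round -/

section InitialRound

/-- The error of a mini-batch estimate. -/
def batchErr (𝓜 : Model n d S A) (I : Input n d) (i : Fin n) (x : Fin I.B → 𝓜.AgentTraj i) :
    Param d :=
  ∑ b, (1 / (I.B : ℝ)) • (𝓜.gradEst i (x b) I.θ₀ - gradient (𝓜.localValue i) I.θ₀)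

theorem v_initState (hB : 0 < I.B) (τ₀ : ∀ i, Fin I.B → 𝓜.AgentTraj i) (i : Fin n) :
    (initState 𝓜 I τ₀).v i = gradient (𝓜.localValue i) I.θ₀ + batchErr 𝓜 I i (τ₀ i) := by
  have hB' : (I.B : ℝ) ≠ 0 := by positivity
  simp only [initState, batchErr, ← Finset.smul_sum, Finset.sum_sub_distrib, smul_sub]
  simp [← Nat.cast_smul_eq_nsmul ℝ, smul_smul, hB']

theorem gradErr_initState (hB : 0 < I.B) (τ₀ : ∀ i, Fin I.B → 𝓜.AgentTraj i) (i : Fin n) :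
    gradErr 𝓜 (initState 𝓜 I τ₀) i = batchErr 𝓜 I i (τ₀ i) := by
  rw [gradErr, v_initState hB]
  exact add_sub_cancel_left _ _

variable (hlog : 𝓜.LogPolicyBounded G M)
include hlog

theorem Model.LogPolicyBounded.sum_trajProb_smul_gradEst_sub (i : Fin n) (θ : Param d) :
    ∑ τ, 𝓜.trajProb i θ τ • (𝓜.gradEst i τ θ - gradient (𝓜.localValue i) θ) = 0 := by
  simp only [smul_sub, Finset.sum_sub_distrib, ← Finset.sum_smul, Model.sum_trajProb, one_smul,
    hlog.gradient_localValue, sub_self]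

theorem sum_prod_trajProb_smul_batchErr (i : Fin n) :
    ∑ x : Fin I.B → 𝓜.AgentTraj i, (∏ b, 𝓜.trajProb i I.θ₀ (x b)) • batchErr 𝓜 I i x = 0 := by
  simp only [batchErr, Finset.smul_sum]
  rw [Finset.sum_comm]
  refine Finset.sum_eq_zero fun b _ => ?_
  rw [sum_pi_coord (p := fun _ => 𝓜.trajProb i I.θ₀) (fun _ => 𝓜.sum_trajProb i _) b
    (fun τ => (1 / (I.B : ℝ)) • (𝓜.gradEst i τ I.θ₀ - gradient (𝓜.localValue i) I.θ₀))]
  simp only [smul_comm _ (1 / (I.B : ℝ)), ← Finset.smul_sum,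
    hlog.sum_trajProb_smul_gradEst_sub, smul_zero]

theorem sum_prod_trajProb_mul_norm_batchErr_sq_le (hvar : 𝓜.GradEstVarBounded ν) (hB : 0 < I.B)
    (i : Fin n) :
    ∑ x : Fin I.B → 𝓜.AgentTraj i, (∏ b, 𝓜.trajProb i I.θ₀ (x b)) * ‖batchErr 𝓜 I i x‖ ^ 2 ≤
      ν i ^ 2 / I.B := by
  have hB' : (0 : ℝ) < I.B := by positivity
  have h := sum_pi_norm_add_sum_sq (p := fun _ : Fin I.B => 𝓜.trajProb i I.θ₀)
    (fun _ => 𝓜.sum_trajProb i _) (0 : Param d)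
    (fun _ τ => (1 / (I.B : ℝ)) • (𝓜.gradEst i τ I.θ₀ - gradient (𝓜.localValue i) I.θ₀))
    fun _ => by
      simp only [smul_comm _ (1 / (I.B : ℝ)), ← Finset.smul_sum,
        hlog.sum_trajProb_smul_gradEst_sub, smul_zero]
  simp only [zero_add] at h
  refine (le_of_eq h).trans ?_
  simp only [norm_smul, mul_pow, Real.norm_eq_abs, sq_abs, mul_left_comm _ ((1 / (I.B : ℝ)) ^ 2),
    ← Finset.mul_sum]
  have h2 := hvar i I.θ₀
  simp only [Model.trajExp, smul_eq_mul] at h2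
  have h3 := mul_le_mul_of_nonneg_left h2 (show 0 ≤ 1 / (I.B : ℝ) by positivity)
  simp only [norm_zero, Finset.sum_const, Finset.card_univ, Fintype.card_fin, nsmul_eq_mul]
  calc _ = 1 / (I.B : ℝ) * ∑ τ, 𝓜.trajProb i I.θ₀ τ *
        ‖𝓜.gradEst i τ I.θ₀ - gradient (𝓜.localValue i) I.θ₀‖ ^ 2 := by
        field_simp
        ring
    _ ≤ _ := h3
    _ = _ := by ring

variable (hvar : 𝓜.GradEstVarBounded ν) (hB : 0 < I.B)
include hvar hB

theorem batchExp_avg_gradErr_le :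
    batchExp 𝓜 I (fun s => ‖avg (gradErr 𝓜 s)‖ ^ 2) ≤
      (1 / (n : ℝ)) ^ 2 * ∑ i, ν i ^ 2 / I.B := by
  have h := sum_pi_norm_add_sum_sq
    (p := fun i (x : Fin I.B → 𝓜.AgentTraj i) => ∏ b, 𝓜.trajProb i I.θ₀ (x b))
    (fun i => sum_prod_trajProb_batch 𝓜 i I.B I.θ₀) (0 : Param d)
    (fun i x => (1 / (n : ℝ)) • batchErr 𝓜 I i x) fun i => by
      simp only [smul_comm _ (1 / (n : ℝ)), ← Finset.smul_sum,
        sum_prod_trajProb_smul_batchErr hlog, smul_zero]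
  simp only [zero_add, ← Finset.smul_sum] at h
  simp only [batchExp, avg, gradErr_initState hB]
  rw [h]
  simp only [norm_smul, mul_pow, Real.norm_eq_abs, sq_abs, mul_left_comm _ ((1 / (n : ℝ)) ^ 2),
    ← Finset.mul_sum]
  simp only [norm_zero, ne_eq, OfNat.ofNat_ne_zero, not_false_eq_true, zero_pow, zero_add]
  gcongr with i
  exact sum_prod_trajProb_mul_norm_batchErr_sq_le hlog hvar hB i

theorem batchExp_sum_sq_le (a : Fin n → Param d) (φ : State n d → Fin n → Param d)
    (hφ : ∀ τ₀ i, φ (initState 𝓜 I τ₀) i = a i + batchErr 𝓜 I i (τ₀ i)) :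
    batchExp 𝓜 I (fun s => ∑ i, ‖φ s i‖ ^ 2) ≤ ∑ i, ‖a i‖ ^ 2 + ∑ i, ν i ^ 2 / I.B := by
  simp only [batchExp, hφ, Finset.mul_sum]
  rw [Finset.sum_comm, ← Finset.sum_add_distrib]
  refine Finset.sum_le_sum fun i _ => ?_
  rw [sum_pi_coord_mul
    (p := fun i (x : Fin I.B → 𝓜.AgentTraj i) => ∏ b, 𝓜.trajProb i I.θ₀ (x b))
    (fun i => sum_prod_trajProb_batch 𝓜 i I.B I.θ₀) i
    (fun x => ‖a i + batchErr 𝓜 I i x‖ ^ 2),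
    sum_mul_norm_add_sq (sum_prod_trajProb_batch 𝓜 i I.B I.θ₀) _
      (sum_prod_trajProb_smul_batchErr hlog i)]
  gcongr
  exact sum_prod_trajProb_mul_norm_batchErr_sq_le hlog hvar hB i

theorem batchExp_sum_gradErr_le :
    batchExp 𝓜 I (fun s => ∑ i, ‖gradErr 𝓜 s i‖ ^ 2) ≤ ∑ i, ν i ^ 2 / I.B := by
  refine (batchExp_sum_sq_le hlog hvar hB 0 (gradErr 𝓜) fun τ₀ i => ?_).trans (by simp)
  rw [gradErr_initState hB, Pi.zero_apply, zero_add]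

/-- The first tracker is already a mixture of the first estimators, hence the factor `ρ²` on the
initial data. -/
theorem batchExp_dev_y_le (hn : 0 < n) (hW : IsMixing I.𝒢 I.W) :
    batchExp 𝓜 I (fun s => dev s.y) ≤ mixRate I.W ^ 2 *
      (∑ i, ‖gradient (𝓜.localValue i) I.θ₀‖ ^ 2 + ∑ i, ν i ^ 2 / I.B) := by
  refine le_trans ?_ (mul_le_mul_of_nonneg_left (batchExp_sum_sq_le hlog hvar hB _ State.v
    (v_initState hB)) (sq_nonneg _))
  rw [batchExp, batchExp, Finset.mul_sum]
  refine Finset.sum_le_sum fun τ₀ _ => ?_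
  rw [mul_left_comm]
  refine mul_le_mul_of_nonneg_left ?_ (Finset.prod_nonneg fun _ _ => Finset.prod_nonneg
    fun _ _ => 𝓜.trajProb_nonneg _ _ _)
  exact (hW.dev_mix_le hn _).trans
    (mul_le_mul_of_nonneg_left (dev_le_sum_norm_sq hn _) (sq_nonneg _))

end InitialRound

end

section

variable {n d : ℕ} {S : Fin n → Type u} {A : Type v} [∀ i, Fintype (S i)] [Fintype A]
  {𝓜 : Model n d S A} {I : Input n d} {G M Wv μF : ℝ} {ν : Fin n → ℝ}

/-! ### The global value function -/

section Value

variable (hlog : 𝓜.LogPolicyBounded G M)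
include hlog

theorem Model.LogPolicyBounded.hasGradientAt_value (θ : Param d) :
    HasGradientAt 𝓜.value (avg fun i => gradient (𝓜.localValue i) θ) θ := by
  rw [hasGradientAt_iff_hasFDerivAt, avg, map_smul, map_sum]
  refine HasFDerivAt.const_mul (HasFDerivAt.fun_sum fun i _ => ?_) _
  rw [hlog.gradient_localValue]
  exact (hlog.hasGradientAt_localValue i θ).hasFDerivAt

theorem Model.LogPolicyBounded.gradient_value (θ : Param d) :
    gradient 𝓜.value θ = avg fun i => gradient (𝓜.localValue i) θ :=
  (hlog.hasGradientAt_value θ).gradient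

theorem Model.LogPolicyBounded.constL_nonneg (hn : 0 < n) : 0 ≤ 𝓜.constL G M := by
  have hG := hlog.G_nonneg ⟨0, hn⟩
  have hM := hlog.M_nonneg ⟨0, hn⟩
  have := 𝓜.one_sub_γ_pos
  rw [Model.constL]
  positivity

theorem norm_avg_gradient_sub_sq_le (hn : 0 < n) (θ : Fin n → Param d) :
    n * ‖(avg fun i => gradient (𝓜.localValue i) (θ i)) - gradient 𝓜.value (avg θ)‖ ^ 2 ≤
      𝓜.constL G M ^ 2 * dev θ := by
  rw [hlog.gradient_value, ← avg_sub]
  refine (mul_norm_avg_sq_le hn _).trans ?_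
  rw [dev, Finset.mul_sum]
  refine Finset.sum_le_sum fun i _ => ?_
  rw [← mul_pow]
  exact pow_le_pow_left₀ (norm_nonneg _) (hlog.norm_gradient_localValue_sub_le i _ _) 2

theorem norm_gradient_value_sub_le (hn : 0 < n) (x y : Param d) :
    ‖gradient 𝓜.value x - gradient 𝓜.value y‖ ≤ 𝓜.constL G M * ‖x - y‖ := by
  have hn' : (n : ℝ) ≠ 0 := by positivity
  rw [hlog.gradient_value, hlog.gradient_value, ← avg_sub, avg, norm_smul]
  refine (mul_le_mul_of_nonneg_left (norm_sum_le_of_le _ fun i _ =>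
    hlog.norm_gradient_localValue_sub_le i x y) (norm_nonneg _)).trans (le_of_eq ?_)
  simp [hn']

theorem sum_norm_gradient_value_sq_le (hn : 0 < n) (θ : Fin n → Param d) :
    ∑ i, ‖gradient 𝓜.value (θ i)‖ ^ 2 ≤
      2 * n * ‖gradient 𝓜.value (avg θ)‖ ^ 2 + 2 * 𝓜.constL G M ^ 2 * dev θ := by
  have h : ∀ i, ‖gradient 𝓜.value (θ i)‖ ^ 2 ≤ 2 * ‖gradient 𝓜.value (avg θ)‖ ^ 2 +
      2 * 𝓜.constL G M ^ 2 * ‖θ i - avg θ‖ ^ 2 := by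
    intro i
    have h1 := norm_add_sq_le_two_mul (gradient 𝓜.value (avg θ))
      (gradient 𝓜.value (θ i) - gradient 𝓜.value (avg θ))
    rw [add_sub_cancel] at h1
    have h2 := pow_le_pow_left₀ (norm_nonneg _) (norm_gradient_value_sub_le hlog hn (θ i) (avg θ)) 2
    rw [mul_pow] at h2
    linarith
  refine (Finset.sum_le_sum fun i _ => h i).trans (le_of_eq ?_)
  rw [Finset.sum_add_distrib, dev, Finset.mul_sum]
  simp only [Finset.sum_const, Finset.card_univ, Fintype.card_fin, nsmul_eq_mul]
  ring

end Value

/-! ### Inequalities along a run -/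

section Pathwise

variable (𝓜) in
/-- The natural gradient directions `F_i(θ_i)⁻¹ y_i`. -/
def natDir (θ y : Fin n → Param d) (i : Fin n) : Param d :=
  Matrix.toEuclideanLin (𝓜.fisher i (θ i))⁻¹ (y i)

theorem sum_norm_natDir_sq_le (hμ : 0 < μF) (hF : 𝓜.FisherLowerBound μF)
    (θ y : Fin n → Param d) :
    ∑ i, ‖natDir 𝓜 θ y i‖ ^ 2 ≤ 1 / μF ^ 2 * ∑ i, ‖y i‖ ^ 2 := by
  rw [Finset.mul_sum]
  refine Finset.sum_le_sum fun i _ => ?_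
  refine (pow_le_pow_left₀ (norm_nonneg _) (norm_inverse_apply_le
    (hF.fisher_inv_apply hμ i (θ i)) hμ (hF.inner_fisher_ge i (θ i)) (y i)) 2).trans (le_of_eq ?_)
  ring

theorem Consistent.θnext_eq_mix {s : State n d} (hs : Consistent 𝓜 I s) :
    s.θnext = mix I.𝒢 I.W fun i => s.θ i + I.η • natDir 𝓜 s.θ s.y i :=
  hs.θnext_eq

theorem Consistent.avg_θnext {s : State n d} (hs : Consistent 𝓜 I s)
    (hW : IsMixing I.𝒢 I.W) :
    avg s.θnext = avg s.θ + I.η • avg (natDir 𝓜 s.θ s.y) := by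
  rw [hs.θnext_eq_mix, hW.avg_mix, avg_add, avg_smul]

theorem sum_norm_smul_natDir_sq_le (hμ : 0 < μF) (hF : 𝓜.FisherLowerBound μF)
    (θ y : Fin n → Param d) :
    ∑ i, ‖I.η • natDir 𝓜 θ y i‖ ^ 2 ≤ I.η ^ 2 / μF ^ 2 * ∑ i, ‖y i‖ ^ 2 := by
  simp only [norm_smul, mul_pow, Real.norm_eq_abs, sq_abs, ← Finset.mul_sum]
  have := mul_le_mul_of_nonneg_left (sum_norm_natDir_sq_le hμ hF θ y) (sq_nonneg I.η)
  refine this.trans (le_of_eq ?_)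
  ring

variable {s : State n d} (hs : Consistent 𝓜 I s) (hn : 0 < n) (hW : IsMixing I.𝒢 I.W)
  (hμ : 0 < μF) (hF : 𝓜.FisherLowerBound μF)
include hs hn hW hμ hF

theorem dev_θnext_le (hρ : mixRate I.W ^ 2 < 1) :
    dev s.θnext ≤ (1 + mixRate I.W ^ 2) / 2 * dev s.θ +
      2 * mixRate I.W ^ 2 / (1 - mixRate I.W ^ 2) *
        (I.η ^ 2 / μF ^ 2 * ∑ i, ‖s.y i‖ ^ 2) := by
  have hq : 0 < 1 - mixRate I.W ^ 2 := by linarith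
  rw [hs.θnext_eq_mix]
  refine (hW.dev_mix_add_le hn hρ _ _).trans ?_
  gcongr
  exact sum_norm_smul_natDir_sq_le hμ hF s.θ s.y

/-- The movement splits orthogonally into the movement of the average, controlled by the natural
gradient step alone, and a deviation, controlled by the deviations before and after. -/
theorem moveSq_le (hρ : mixRate I.W ^ 2 < 1) :
    moveSq s ≤ 4 * dev s.θ +
      5 / (1 - mixRate I.W ^ 2) * (I.η ^ 2 / μF ^ 2 * ∑ i, ‖s.y i‖ ^ 2) := by
  have hq : 0 < 1 - mixRate I.W ^ 2 := by linarith
  have h1 := dev_θnext_le hs hn hW hμ hF hρ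
  have h2 := sum_norm_smul_natDir_sq_le (I := I) hμ hF s.θ s.y
  set Z := I.η ^ 2 / μF ^ 2 * ∑ i, ‖s.y i‖ ^ 2 with hZ
  have hZ0 : 0 ≤ Z := by positivity
  have h3 : dev (fun i => s.θnext i - s.θ i) ≤ 2 * dev s.θnext + 2 * dev s.θ := by
    simp only [dev, avg_sub, Finset.mul_sum, ← Finset.sum_add_distrib]
    refine Finset.sum_le_sum fun i _ => ?_
    have h : s.θnext i - s.θ i - (avg s.θnext - avg s.θ) =
        (s.θnext i - avg s.θnext) - (s.θ i - avg s.θ) := by abel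
    rw [h]
    exact norm_sub_sq_le_two_mul _ _
  have h4 : n * ‖avg fun i => s.θnext i - s.θ i‖ ^ 2 ≤ Z := by
    rw [avg_sub, hs.avg_θnext hW, add_sub_cancel_left, ← avg_smul]
    exact (mul_norm_avg_sq_le hn _).trans h2
  have h5 : moveSq s = dev (fun i => s.θnext i - s.θ i) +
      n * ‖avg fun i => s.θnext i - s.θ i‖ ^ 2 := sum_norm_sq_eq hn _
  have h6 : (1 + mixRate I.W ^ 2) / 2 * dev s.θ ≤ dev s.θ :=
    mul_le_of_le_one_left (dev_nonneg _) (by linarith)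
  -- The exact coefficient is `(1 + 3ρ²) / (1 - ρ²)`; 5 is a convenient upper bound for the
  -- numerator.
  have h7 : 2 * (2 * mixRate I.W ^ 2 / (1 - mixRate I.W ^ 2) * Z) + Z ≤
      5 / (1 - mixRate I.W ^ 2) * Z := by
    have h8 : 5 / (1 - mixRate I.W ^ 2) * Z -
        (2 * (2 * mixRate I.W ^ 2 / (1 - mixRate I.W ^ 2) * Z) + Z) = 4 * Z +
          mixRate I.W ^ 2 / (1 - mixRate I.W ^ 2) * Z := by
      field_simp
      ring
    have h9 : 0 ≤ 4 * Z + mixRate I.W ^ 2 / (1 - mixRate I.W ^ 2) * Z := by positivity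
    linarith
  linarith

theorem descent (hlog : 𝓜.LogPolicyBounded G M) (hG : 0 < G) (hη : 0 < I.η) :
    I.η / (2 * G) * (‖gradient 𝓜.value (avg s.θ)‖ ^ 2 + (∑ i, ‖s.y i‖ ^ 2) / n) ≤
      𝓜.value (avg s.θnext) - 𝓜.value (avg s.θ) +
      I.η / (2 * μF) * (dev s.y / n + 2 * ‖avg (gradErr 𝓜 s)‖ ^ 2 +
        2 * 𝓜.constL G M ^ 2 * dev s.θ / n) +
      𝓜.constL G M * I.η ^ 2 / (2 * μF ^ 2) * ((∑ i, ‖s.y i‖ ^ 2) / n) := by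
  have hn' : (0 : ℝ) < n := by positivity
  set x := gradient 𝓜.value (avg s.θ) with hx
  set Y := ∑ i, ‖s.y i‖ ^ 2 with hY
  set h := natDir 𝓜 s.θ s.y with hh
  -- The quadratic upper bound for `-V` is the lower bound needed for ascent.
  have hsmooth := le_of_lipschitz_gradient (f := fun θ => -𝓜.value θ)
    (g := fun θ => -gradient 𝓜.value θ) (K := 𝓜.constL G M)
    (fun z => by
      have h1 := (hlog.hasGradientAt_value z).hasFDerivAt.neg
      rw [← hlog.gradient_value, ← map_neg] at h1
      exact hasGradientAt_iff_hasFDerivAt.2 h1)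
    (fun z w => by
      rw [neg_sub_neg, norm_sub_rev]
      exact norm_gradient_value_sub_le hlog hn z w) (avg s.θ) (avg s.θnext)
  rw [hs.avg_θnext hW, add_sub_cancel_left, ← hs.avg_θnext hW, ← hx, ← hh, inner_neg_left,
    inner_smul_right, norm_smul, mul_pow, Real.norm_eq_abs, sq_abs] at hsmooth
  have hnorm : ‖avg h‖ ^ 2 ≤ 1 / μF ^ 2 * (Y / n) := by
    have h1 := (mul_norm_avg_sq_le hn h).trans (sum_norm_natDir_sq_le hμ hF s.θ s.y)
    rw [mul_div_assoc', le_div_iff₀ hn', mul_comm]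
    exact h1
  have hinner : (‖x‖ ^ 2 + Y / n) / (2 * G) - (∑ i, ‖s.y i - x‖ ^ 2) / n / (2 * μF) ≤
      inner ℝ x (avg h) := by
    rw [avg, inner_smul_right, inner_sum]
    have h1 : ∀ i, (‖x‖ ^ 2 + ‖s.y i‖ ^ 2) / (2 * G) - ‖s.y i - x‖ ^ 2 / (2 * μF) ≤
        inner ℝ x (h i) := by
      intro i
      rw [norm_sub_rev]
      exact inner_inverse_apply_ge (hF.fisher_inv_apply hμ i (s.θ i))
        (𝓜.inner_fisher_symm i (s.θ i)) hμ (hF.inner_fisher_ge i (s.θ i))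
        (hlog.inner_fisher_le i (s.θ i)) hG x (s.y i)
    have h2 := mul_le_mul_of_nonneg_left
      (Finset.sum_le_sum fun i (_ : i ∈ Finset.univ) => h1 i) (show 0 ≤ 1 / (n : ℝ) by positivity)
    refine le_trans (le_of_eq ?_) h2
    rw [Finset.sum_sub_distrib, ← Finset.sum_div, ← Finset.sum_div, Finset.sum_add_distrib]
    simp only [Finset.sum_const, Finset.card_univ, Fintype.card_fin, nsmul_eq_mul]
    field_simp
    ring
  -- Bias and variance of the trackers: their average is that of `v`, whose distance to `∇V(θ̄)` is
  -- the averaged estimation error plus the effect of evaluating the gradients at different `θ_i`.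
  have herr : (∑ i, ‖s.y i - x‖ ^ 2) / n ≤ dev s.y / n + 2 * ‖avg (gradErr 𝓜 s)‖ ^ 2 +
      2 * 𝓜.constL G M ^ 2 * dev s.θ / n := by
    rw [sum_norm_sub_sq_eq hn, hs.avg_y]
    have h1 : avg s.v - x = avg (gradErr 𝓜 s) +
        ((avg fun i => gradient (𝓜.localValue i) (s.θ i)) - x) := by
      have : avg (gradErr 𝓜 s) = avg s.v - avg fun i => gradient (𝓜.localValue i) (s.θ i) :=
        avg_sub _ _
      rw [this]
      abel
    have h2 := norm_add_sq_le_two_mul (avg (gradErr 𝓜 s))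
      ((avg fun i => gradient (𝓜.localValue i) (s.θ i)) - x)
    rw [← h1] at h2
    have h3 := norm_avg_gradient_sub_sq_le hlog hn s.θ
    have h4 : ‖(avg fun i => gradient (𝓜.localValue i) (s.θ i)) - x‖ ^ 2 ≤
        𝓜.constL G M ^ 2 * dev s.θ / n := by
      rw [le_div_iff₀ hn', mul_comm]
      exact h3
    rw [add_div, mul_div_cancel_left₀ _ hn'.ne']
    have h5 : 2 * 𝓜.constL G M ^ 2 * dev s.θ / n = 2 * (𝓜.constL G M ^ 2 * dev s.θ / n) := by ring
    linarith
  have h1 := mul_le_mul_of_nonneg_left hinner hη.le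
  have h2 := mul_le_mul_of_nonneg_left herr (show 0 ≤ I.η / (2 * μF) by positivity)
  have h3 := mul_le_mul_of_nonneg_left hnorm
    (show 0 ≤ 𝓜.constL G M / 2 * I.η ^ 2 by have := hlog.constL_nonneg hn; positivity)
  have h4 : I.η * ((‖x‖ ^ 2 + Y / n) / (2 * G) - (∑ i, ‖s.y i - x‖ ^ 2) / n / (2 * μF)) =
      I.η / (2 * G) * (‖x‖ ^ 2 + Y / n) -
      I.η / (2 * μF) * ((∑ i, ‖s.y i - x‖ ^ 2) / n) := by ring
  have h5 : 𝓜.constL G M / 2 * I.η ^ 2 * (1 / μF ^ 2 * (Y / n)) =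
      𝓜.constL G M * I.η ^ 2 / (2 * μF ^ 2) * (Y / n) := by ring
  rw [h4] at h1
  rw [h5] at h3
  linarith

end Pathwise

theorem stepExp_θ (φ : (Fin n → Param d) → ℝ) (s : State n d) :
    stepExp 𝓜 I (fun s => φ s.θ) s = φ s.θnext := by
  have h : ∀ τ, (step 𝓜 I s τ).θ = s.θnext := fun _ => rfl
  simp only [stepExp, h, ← Finset.sum_mul]
  rw [sum_prod_trajProb 𝓜 s.θnext, one_mul]

/-- Summing a contraction with a perturbation. -/
theorem one_sub_mul_sum_le {a b : ℕ → ℝ} {x : ℝ} {T : ℕ} (hx : 0 ≤ x) (ha : ∀ t, 0 ≤ a t)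
    (h : ∀ t < T, a (t + 1) ≤ x * a t + b t) :
    (1 - x) * ∑ t ∈ Finset.range (T + 1), a t ≤ a 0 + ∑ t ∈ Finset.range T, b t := by
  have h1 : ∑ t ∈ Finset.range T, a (t + 1) ≤
      x * ∑ t ∈ Finset.range T, a t + ∑ t ∈ Finset.range T, b t := by
    rw [Finset.mul_sum, ← Finset.sum_add_distrib]
    exact Finset.sum_le_sum fun t ht => h t (Finset.mem_range.1 ht)
  have h2 := Finset.sum_range_succ' a T
  have h3 := Finset.sum_range_succ a T
  have h4 := mul_nonneg hx (ha T)
  have h5 : x * ∑ t ∈ Finset.range (T + 1), a t = x * ∑ t ∈ Finset.range T, a t + x * a T := by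
    rw [h3, mul_add]
  linarith

end

section

variable {n d : ℕ} {S : Fin n → Type u} {A : Type v} [∀ i, Fintype (S i)] [Fintype A]

/-! ### Sums over the rounds -/

section RunSum

variable (𝓜 : Model n d S A) (I : Input n d)

/-- The sum of the expectations of `φ` over the rounds `0, …, T`. -/
def runSum (φ : State n d → ℝ) : ℝ := ∑ t ∈ Finset.range (I.T + 1), runExp 𝓜 I t φ

theorem runSum_add (φ ψ : State n d → ℝ) :
    runSum 𝓜 I (fun s => φ s + ψ s) = runSum 𝓜 I φ + runSum 𝓜 I ψ := by
  simp only [runSum, runExp_add, Finset.sum_add_distrib]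

theorem runSum_mul_left (c : ℝ) (φ : State n d → ℝ) :
    runSum 𝓜 I (fun s => c * φ s) = c * runSum 𝓜 I φ := by
  simp only [runSum, runExp_mul_left, Finset.mul_sum]

variable {𝓜 I}

theorem IsMixing.runSum_mono (hW : IsMixing I.𝒢 I.W) {φ ψ : State n d → ℝ}
    (h : ∀ s, Consistent 𝓜 I s → φ s ≤ ψ s) : runSum 𝓜 I φ ≤ runSum 𝓜 I ψ :=
  Finset.sum_le_sum fun t _ => hW.runExp_mono 𝓜 I t h

theorem runExp_nonneg (t : ℕ) {φ : State n d → ℝ} (h : ∀ s, 0 ≤ φ s) : 0 ≤ runExp 𝓜 I t φ :=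
  Finset.sum_nonneg fun ω _ => mul_nonneg (pathProb_nonneg 𝓜 I ω) (h _)

theorem runSum_nonneg {φ : State n d → ℝ} (h : ∀ s, 0 ≤ φ s) : 0 ≤ runSum 𝓜 I φ :=
  Finset.sum_nonneg fun t _ => runExp_nonneg t h

/-- The common mechanism for all four error recursions: contraction by `x`, a constant source `k`
and a source `ψ` depending on the state. -/
theorem IsMixing.one_sub_mul_runSum_le (hW : IsMixing I.𝒢 I.W) {φ ψ : State n d → ℝ} {x k : ℝ}
    (hx : 0 ≤ x) (hφ : ∀ s, 0 ≤ φ s) (hψ : ∀ s, 0 ≤ ψ s)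
    (h : ∀ s, Consistent 𝓜 I s → stepExp 𝓜 I φ s ≤ x * φ s + (k + ψ s)) :
    (1 - x) * runSum 𝓜 I φ ≤ batchExp 𝓜 I φ + (I.T * k + runSum 𝓜 I ψ) := by
  have h1 : ∀ t < I.T, runExp 𝓜 I (t + 1) φ ≤
      x * runExp 𝓜 I t φ + (k + runExp 𝓜 I t ψ) := by
    intro t ht
    rw [runExp_succ 𝓜 I ht]
    refine (hW.runExp_mono 𝓜 I t h).trans (le_of_eq ?_)
    rw [runExp_add, runExp_mul_left, runExp_add, runExp_const 𝓜 I ht.le]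
  have h2 := one_sub_mul_sum_le hx (fun t => runExp_nonneg (𝓜 := 𝓜) (I := I) t hφ) h1
  -- There are `T` transitions but `T + 1` rounds in `runSum`; the extra term of `ψ` is nonnegative.
  have h3 : ∑ t ∈ Finset.range I.T, (k + runExp 𝓜 I t ψ) ≤ I.T * k + runSum 𝓜 I ψ := by
    rw [Finset.sum_add_distrib, runSum, Finset.sum_range_succ]
    have := runExp_nonneg (𝓜 := 𝓜) (I := I) I.T hψ
    simp
    exact this
  rw [runExp_zero] at h2
  exact h2.trans (add_le_add_right h3 _)

/-- Telescoping a function of the parameters. -/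
theorem runSum_θnext_sub_θ (φ : (Fin n → Param d) → ℝ) :
    runSum 𝓜 I (fun s => φ s.θnext) - runSum 𝓜 I (fun s => φ s.θ) =
      runExp 𝓜 I I.T (fun s => φ s.θnext) - runExp 𝓜 I 0 (fun s => φ s.θ) := by
  have h : ∀ t ∈ Finset.range I.T, runExp 𝓜 I (t + 1) (fun s => φ s.θ) =
      runExp 𝓜 I t (fun s => φ s.θnext) := by
    intro t ht
    rw [runExp_succ 𝓜 I (Finset.mem_range.1 ht)]
    congr 1
    ext s
    exact stepExp_θ φ s
  rw [runSum, runSum, Finset.sum_range_succ, Finset.sum_range_succ', Finset.sum_congr rfl h]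
  ring

theorem runExp_zero_θ (φ : (Fin n → Param d) → ℝ) :
    runExp 𝓜 I 0 (fun s => φ s.θ) = φ fun _ => I.θ₀ := by
  have h := runExp_const 𝓜 I (Nat.zero_le _) (φ fun _ => I.θ₀)
  rw [runExp_zero] at h ⊢
  exact h

end RunSum

/-! ### The error recursions and the ascent inequality, summed over the rounds -/

section Bounds

variable {𝓜 : Model n d S A} {I : Input n d} {G M Wv μF : ℝ} {ν : Fin n → ℝ}

theorem Model.LogPolicyBounded.constΦSq_nonneg (hlog : 𝓜.LogPolicyBounded G M)
    (himp : 𝓜.ImpWeightVarBounded Wv) (hn : 0 < n) : 0 ≤ 𝓜.constΦSq G M Wv := by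
  have hG := hlog.G_nonneg ⟨0, hn⟩
  have hM := hlog.M_nonneg ⟨0, hn⟩
  have hWv : 0 ≤ Wv := by
    refine le_trans ?_ (himp ⟨0, hn⟩ 0 0)
    exact Finset.sum_nonneg fun τ _ => mul_nonneg (𝓜.trajProb_nonneg _ _ τ) (sq_nonneg _)
  rw [Model.constΦSq, Model.constCωSq]
  positivity

theorem runSum_dev_θ_le (hn : 0 < n) (hW : IsMixing I.𝒢 I.W) (hρ : mixRate I.W ^ 2 < 1)
    (hμ : 0 < μF) (hF : 𝓜.FisherLowerBound μF) :
    (1 - mixRate I.W ^ 2) / 2 * runSum 𝓜 I (fun s => dev s.θ) ≤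
      2 * mixRate I.W ^ 2 / (1 - mixRate I.W ^ 2) *
        (I.η ^ 2 / μF ^ 2 * runSum 𝓜 I fun s => ∑ i, ‖s.y i‖ ^ 2) := by
  have hq : 0 < 1 - mixRate I.W ^ 2 := by linarith
  have h := hW.one_sub_mul_runSum_le (𝓜 := 𝓜) (φ := fun s => dev s.θ)
    (ψ := fun s => 2 * mixRate I.W ^ 2 / (1 - mixRate I.W ^ 2) *
        (I.η ^ 2 / μF ^ 2 * ∑ i, ‖s.y i‖ ^ 2)) (x := (1 + mixRate I.W ^ 2) / 2) (k := 0)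
    (by positivity) (fun s => dev_nonneg _) (fun s => by positivity) fun s hs => by
      rw [stepExp_θ dev s, zero_add]
      exact dev_θnext_le hs hn hW hμ hF hρ
  -- All agents start from the same parameter.
  have h0 : batchExp 𝓜 I (fun s => dev s.θ) = 0 := by
    rw [← runExp_zero, runExp_zero_θ dev, dev]
    simp [avg_const hn]
  rw [h0, runSum_mul_left, runSum_mul_left] at h
  have h1 : 1 - (1 + mixRate I.W ^ 2) / 2 = (1 - mixRate I.W ^ 2) / 2 := by ring
  rw [h1] at h
  linarith

theorem runSum_moveSq_le (hn : 0 < n) (hW : IsMixing I.𝒢 I.W) (hρ : mixRate I.W ^ 2 < 1)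
    (hμ : 0 < μF) (hF : 𝓜.FisherLowerBound μF) :
    runSum 𝓜 I moveSq ≤ 4 * runSum 𝓜 I (fun s => dev s.θ) + 5 / (1 - mixRate I.W ^ 2) *
        (I.η ^ 2 / μF ^ 2 * runSum 𝓜 I fun s => ∑ i, ‖s.y i‖ ^ 2) := by
  refine (hW.runSum_mono fun s hs => moveSq_le hs hn hW hμ hF hρ).trans (le_of_eq ?_)
  rw [runSum_add, runSum_mul_left, runSum_mul_left, runSum_mul_left]

theorem moveSq_nonneg (s : State n d) : 0 ≤ moveSq s := Finset.sum_nonneg fun _ _ => sq_nonneg _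

section Estimators

variable (hn : 0 < n) (hW : IsMixing I.𝒢 I.W) (hlog : 𝓜.LogPolicyBounded G M)
  (himp : 𝓜.ImpWeightVarBounded Wv) (hvar : 𝓜.GradEstVarBounded ν) (hβ0 : 0 ≤ I.β)
  (hβ1 : I.β ≤ 1) (hB : 0 < I.B)
include hn hW hlog himp hvar hβ0 hβ1 hB

theorem runSum_avg_gradErr_le :
    I.β * runSum 𝓜 I (fun s => ‖avg (gradErr 𝓜 s)‖ ^ 2) ≤
      (1 / (n : ℝ)) ^ 2 * ((∑ i, ν i ^ 2) / I.B + (I.T * (2 * I.β ^ 2 * ∑ i, ν i ^ 2) +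
        4 * 𝓜.constΦSq G M Wv * runSum 𝓜 I moveSq)) := by
  have hΦ := hlog.constΦSq_nonneg himp hn
  have h := hW.one_sub_mul_runSum_le (𝓜 := 𝓜) (φ := fun s => ‖avg (gradErr 𝓜 s)‖ ^ 2)
    (ψ := fun s => (1 / (n : ℝ)) ^ 2 * (4 * 𝓜.constΦSq G M Wv) * moveSq s) (x := 1 - I.β)
    (k := (1 / (n : ℝ)) ^ 2 * (2 * I.β ^ 2 * ∑ i, ν i ^ 2))
    (by linarith) (fun s => by positivity)
    (fun s => mul_nonneg (by positivity) (moveSq_nonneg s)) fun s _ => by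
      refine (stepExp_avg_gradErr_le hlog himp hvar hβ0 hβ1 s).trans (le_of_eq ?_)
      ring
  have h0 := batchExp_avg_gradErr_le hlog hvar hB
  rw [← Finset.sum_div] at h0
  rw [runSum_mul_left] at h
  linarith

theorem runSum_sum_gradErr_le :
    I.β * runSum 𝓜 I (fun s => ∑ i, ‖gradErr 𝓜 s i‖ ^ 2) ≤
      (∑ i, ν i ^ 2) / I.B + (I.T * (2 * I.β ^ 2 * ∑ i, ν i ^ 2) +
        4 * 𝓜.constΦSq G M Wv * runSum 𝓜 I moveSq) := by
  have hΦ := hlog.constΦSq_nonneg himp hn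
  have h := hW.one_sub_mul_runSum_le (𝓜 := 𝓜) (φ := fun s => ∑ i, ‖gradErr 𝓜 s i‖ ^ 2)
    (ψ := fun s => (4 * 𝓜.constΦSq G M Wv) * moveSq s) (x := 1 - I.β)
    (k := 2 * I.β ^ 2 * ∑ i, ν i ^ 2)
    (by linarith) (fun s => by positivity)
    (fun s => mul_nonneg (by positivity) (moveSq_nonneg s)) fun s _ =>
      stepExp_sum_gradErr_le hlog himp hvar hβ0 hβ1 s
  have h0 := batchExp_sum_gradErr_le hlog hvar hB
  rw [← Finset.sum_div] at h0
  rw [runSum_mul_left] at h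
  linarith

theorem runSum_dev_y_le (hρ : mixRate I.W ^ 2 < 1) :
    (1 - mixRate I.W ^ 2) / 2 * runSum 𝓜 I (fun s => dev s.y) ≤
      mixRate I.W ^ 2 * (∑ i, ‖gradient (𝓜.localValue i) I.θ₀‖ ^ 2 + (∑ i, ν i ^ 2) / I.B) +
      2 * mixRate I.W ^ 2 / (1 - mixRate I.W ^ 2) * (I.T * (2 * I.β ^ 2 * ∑ i, ν i ^ 2) +
        2 * I.β ^ 2 * runSum 𝓜 I (fun s => ∑ i, ‖gradErr 𝓜 s i‖ ^ 2) +
        (2 * 𝓜.constL G M ^ 2 + 4 * 𝓜.constΦSq G M Wv) * runSum 𝓜 I moveSq) := by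
  have hΦ := hlog.constΦSq_nonneg himp hn
  have hq : 0 < 1 - mixRate I.W ^ 2 := by linarith
  have h := hW.one_sub_mul_runSum_le (𝓜 := 𝓜) (φ := fun s => dev s.y)
    (ψ := fun s => 2 * mixRate I.W ^ 2 / (1 - mixRate I.W ^ 2) *
      (2 * I.β ^ 2 * ∑ i, ‖gradErr 𝓜 s i‖ ^ 2 +
        (2 * 𝓜.constL G M ^ 2 + 4 * 𝓜.constΦSq G M Wv) * moveSq s))
    (x := (1 + mixRate I.W ^ 2) / 2)
    (k := 2 * mixRate I.W ^ 2 / (1 - mixRate I.W ^ 2) * (2 * I.β ^ 2 * ∑ i, ν i ^ 2))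
    (by positivity) (fun s => dev_nonneg _)
    (fun s => by have := moveSq_nonneg s; positivity) fun s _ => by
      refine (stepExp_dev_y_le hlog himp hvar hβ0 hβ1 hn hW hρ s).trans (le_of_eq ?_)
      ring
  have h0 := batchExp_dev_y_le hlog hvar hB hn hW
  rw [← Finset.sum_div] at h0
  rw [runSum_mul_left, runSum_add, runSum_mul_left, runSum_mul_left] at h
  have h1 : 1 - (1 + mixRate I.W ^ 2) / 2 = (1 - mixRate I.W ^ 2) / 2 := by ring
  rw [h1] at h
  linarith

end Estimators

theorem runSum_descent (hn : 0 < n) (hW : IsMixing I.𝒢 I.W) (hlog : 𝓜.LogPolicyBounded G M)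
    (hV : BddAbove (Set.range 𝓜.value)) (hμ : 0 < μF) (hF : 𝓜.FisherLowerBound μF) (hG : 0 < G)
    (hη : 0 < I.η) :
    I.η / (2 * G) * (runSum 𝓜 I (fun s => ‖gradient 𝓜.value (avg s.θ)‖ ^ 2) +
        runSum 𝓜 I (fun s => ∑ i, ‖s.y i‖ ^ 2) / n) ≤
      ((⨆ θ, 𝓜.value θ) - 𝓜.value I.θ₀) +
      I.η / (2 * μF) * (runSum 𝓜 I (fun s => dev s.y) / n +
        2 * runSum 𝓜 I (fun s => ‖avg (gradErr 𝓜 s)‖ ^ 2) +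
        2 * 𝓜.constL G M ^ 2 * runSum 𝓜 I (fun s => dev s.θ) / n) +
      𝓜.constL G M * I.η ^ 2 / (2 * μF ^ 2) * (runSum 𝓜 I (fun s => ∑ i, ‖s.y i‖ ^ 2) / n) := by
  have h := hW.runSum_mono (𝓜 := 𝓜)
    (φ := fun s => I.η / (2 * G) * ‖gradient 𝓜.value (avg s.θ)‖ ^ 2 +
      I.η / (2 * G) / n * ∑ i, ‖s.y i‖ ^ 2)
    (ψ := fun s => 𝓜.value (avg s.θnext) + ((-1) * 𝓜.value (avg s.θ) +
      (I.η / (2 * μF) / n * dev s.y + (I.η / μF * ‖avg (gradErr 𝓜 s)‖ ^ 2 +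
        (I.η / μF * 𝓜.constL G M ^ 2 / n * dev s.θ +
      𝓜.constL G M * I.η ^ 2 / (2 * μF ^ 2) / n * ∑ i, ‖s.y i‖ ^ 2)))))
    fun s hs => by
      have h1 := descent hs hn hW hμ hF hlog hG hη
      refine le_trans (le_of_eq ?_) (h1.trans (le_of_eq ?_)) <;> ring
  simp only [runSum_add, runSum_mul_left] at h
  -- The values telescope to `E V(θ̄^{T+1}) - V(θ^0)`, where `θ^{T+1}` is the `θnext` of round `T`;
  -- its value is at most the supremum.
  have h1 := runSum_θnext_sub_θ (𝓜 := 𝓜) (I := I) fun θ => 𝓜.value (avg θ)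
  rw [runExp_zero_θ fun θ => 𝓜.value (avg θ), avg_const hn] at h1
  have h2 : runExp 𝓜 I I.T (fun s => 𝓜.value (avg s.θnext)) ≤ ⨆ θ, 𝓜.value θ := by
    refine (hW.runExp_mono 𝓜 I I.T (ψ := fun _ => ⨆ θ, 𝓜.value θ)
      fun s _ => le_ciSup hV _).trans (le_of_eq ?_)
    exact runExp_const 𝓜 I le_rfl _
  have h3 : runSum 𝓜 I (fun s => 𝓜.value (avg s.θnext)) +
      -1 * runSum 𝓜 I (fun s => 𝓜.value (avg s.θ)) ≤
      (⨆ θ, 𝓜.value θ) - 𝓜.value I.θ₀ := by linarith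
  refine le_trans (le_of_eq ?_) ((h.trans (le_of_eq (add_assoc _ _ _).symm)).trans
    ((add_le_add_left h3 _).trans (le_of_eq ?_))) <;> ring

theorem runSum_gradient_le (hn : 0 < n) (hW : IsMixing I.𝒢 I.W)
    (hlog : 𝓜.LogPolicyBounded G M) :
    runSum 𝓜 I (fun s => ∑ i, ‖gradient 𝓜.value (s.θ i)‖ ^ 2) ≤
      2 * n * runSum 𝓜 I (fun s => ‖gradient 𝓜.value (avg s.θ)‖ ^ 2) +
        2 * 𝓜.constL G M ^ 2 * runSum 𝓜 I (fun s => dev s.θ) := by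
  refine (hW.runSum_mono fun s _ => sum_norm_gradient_value_sq_le hlog hn s.θ).trans
    (le_of_eq ?_)
  rw [runSum_add, runSum_mul_left, runSum_mul_left]

end Bounds

end

/-! ### Arithmetic of the constants -/

/-- The combination of the bounds on the summed errors. Here `m` is the number of agents, and
`u = η² / μ²` and `ℓ = κ L η / μ` are small, so that the multiples of `Y` are absorbed. -/
theorem combine_error_bounds {m T b β q κ L Φ u ℓ X N Y C D E F R P Q K : ℝ} (hm : 0 < m)
    (hT : 0 ≤ T) (hβ0 : 0 < β) (hβ1 : β ≤ 1) (hq0 : 0 < q) (hq1 : q ≤ 1) (hκ : 1 ≤ κ) (hΦ : 0 ≤ Φ)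
    (hu : 0 ≤ u) (hY : 0 ≤ Y) (hQ : 0 ≤ Q) (hb : 0 < b) (hK : 1632000 = K)
    (hsmall : K * ((L ^ 2 + Φ) * κ ^ 2 * u) ≤ q ^ 6)
    (hβ : K * ((L ^ 2 + Φ) * κ ^ 2 * u) ≤ m * β * q ^ 6)
    (hℓ : ℓ ^ 2 = L ^ 2 * κ ^ 2 * u)
    (hC : q / 2 * C ≤ 2 * (1 - q) / q * (u * Y))
    (hD : D ≤ 4 * C + 5 / q * (u * Y))
    (hE : β * E ≤ (1 / m) ^ 2 * (Q / b + (T * (2 * β ^ 2 * Q) + 4 * Φ * D)))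
    (hF : β * F ≤ Q / b + (T * (2 * β ^ 2 * Q) + 4 * Φ * D))
    (hR : q / 2 * R ≤ (1 - q) * (P + Q / b) +
      2 * (1 - q) / q * (T * (2 * β ^ 2 * Q) + 2 * β ^ 2 * F + (2 * L ^ 2 + 4 * Φ) * D))
    (hN : N + Y / m ≤ X + κ * (R / m + 2 * E + 2 * L ^ 2 * C / m) + ℓ * (Y / m)) :
    2 * m * N + 2 * L ^ 2 * C ≤ 2 * m * (X + κ *
      (2 * (1 - q) / q * ((P + Q / b) / m) + 4 / q ^ 2 * (2 * β * (Q / b) + 4 * β ^ 3 * Q * T +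
        2 * β ^ 2 * Q * T) / m + 2 * Q / (m ^ 2 * β * b) + 4 * β * Q * T / m ^ 2)) := by
  -- Here `q = 1 - ρ²` and `Φ` stands for `Φ²`. The letters `C`, `R` are the summed deviations of
  -- `θ`, `y`; `D` is the movement; `E`, `F` are the averaged and individual estimation errors; `N`,
  -- `Y` are the squared gradients at the average and the squared norms of `y`. All movement is
  -- measured in multiples of `w`.
  set w := u * Y / q ^ 2 with hw
  have hw0 : 0 ≤ w := by positivity
  have hκ0 : 0 < κ := by linarith
  have hQb : 0 ≤ Q / b := by positivity
  have hA : 0 ≤ L ^ 2 + Φ := by positivity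
  have huY : u * Y = w * q ^ 2 := by rw [hw]; field_simp
  have hq2 : q ^ 2 ≤ 1 := pow_le_one₀ hq0.le hq1
  have hq4 : q ^ 4 ≤ 1 := pow_le_one₀ hq0.le hq1
  have hC' : C ≤ 4 * w := by
    have h1 : 2 * (1 - q) / q * (u * Y) = q / 2 * (4 * (1 - q) * w) := by
      rw [huY]
      field_simp
      ring
    rw [h1] at hC
    have h2 := le_of_mul_le_mul_left hC (by positivity)
    have h3 := mul_nonneg hq0.le hw0
    linarith
  have hD' : D ≤ 21 * w := by
    have h1 : 5 / q * (u * Y) = 5 * (w * q) := by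
      rw [huY]
      field_simp
    rw [h1] at hD
    have h2 := mul_le_of_le_one_right hw0 hq1
    linarith
  -- The definition of `w` uses up `q²` of the available `q⁶`.
  have hAw : K * ((L ^ 2 + Φ) * κ ^ 2 * w) ≤ q ^ 4 * Y := by
    have h1 := mul_le_mul_of_nonneg_right hsmall (show 0 ≤ Y / q ^ 2 by positivity)
    calc _ = K * ((L ^ 2 + Φ) * κ ^ 2 * u) * (Y / q ^ 2) := by rw [hw]; ring
      _ ≤ _ := h1
      _ = _ := by field_simp
  have hAβ : K * ((L ^ 2 + Φ) * κ ^ 2 * w) ≤ m * β * Y := by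
    have h1 := mul_le_mul_of_nonneg_right hβ (show 0 ≤ Y / q ^ 2 by positivity)
    calc _ = K * ((L ^ 2 + Φ) * κ ^ 2 * u) * (Y / q ^ 2) := by rw [hw]; ring
      _ ≤ _ := h1
      _ = m * β * Y * q ^ 4 := by field_simp
      _ ≤ _ := mul_le_of_le_one_right (by positivity) hq4
  have hκκ : κ ≤ κ ^ 2 := le_self_pow₀ hκ two_ne_zero
  have hκw : (L ^ 2 + Φ) * κ * w ≤ (L ^ 2 + Φ) * κ ^ 2 * w := by gcongr
  have hAw1 : K * ((L ^ 2 + Φ) * κ * w) ≤ q ^ 2 * Y := by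
    have h1 : q ^ 4 * Y ≤ q ^ 2 * Y :=
      mul_le_mul_of_nonneg_right (pow_le_pow_of_le_one hq0.le hq1 (by norm_num)) hY
    subst hK
    linarith
  have hqY : q ^ 2 * Y ≤ Y := mul_le_of_le_one_left hY hq2
  have hLw : L ^ 2 * w ≤ (L ^ 2 + Φ) * κ * w := by
    have h1 : L ^ 2 * w ≤ (L ^ 2 + Φ) * w := by gcongr; linarith
    have h2 : (L ^ 2 + Φ) * w * 1 ≤ (L ^ 2 + Φ) * w * κ := by gcongr
    linarith
  have hLκw : κ * (L ^ 2 * w) ≤ (L ^ 2 + Φ) * κ * w := by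
    have : L ^ 2 * (κ * w) ≤ (L ^ 2 + Φ) * (κ * w) := by gcongr; linarith
    linarith
  have hΦκw : κ * (Φ * w) ≤ (L ^ 2 + Φ) * κ * w := by
    have : Φ * (κ * w) ≤ (L ^ 2 + Φ) * (κ * w) := by gcongr; linarith [sq_nonneg L]
    linarith
  have hLC : L ^ 2 * C ≤ 4 * (L ^ 2 * w) := by
    have := mul_le_mul_of_nonneg_left hC' (sq_nonneg L)
    linarith
  have hΦD : Φ * D ≤ 21 * (Φ * w) := by
    have := mul_le_mul_of_nonneg_left hD' hΦ
    linarith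
  -- Division by `m β` is where the lower bound on `β` is needed. Every error term is allowed to
  -- return at most `Y / 1000`.
  have hE' : κ * (2 * (m * E)) ≤
      κ * m * (2 * Q / (m ^ 2 * β * b) + 4 * β * Q * T / m ^ 2) + Y / 1000 := by
    have h1 := mul_le_mul_of_nonneg_left hE (show 0 ≤ 2 * κ * m / β by positivity)
    have h2 : 2 * κ * m / β * (β * E) = κ * (2 * (m * E)) := by field_simp
    have h3 : 2 * κ * m / β * ((1 / m) ^ 2 * (Q / b + (T * (2 * β ^ 2 * Q) + 4 * Φ * D))) =
        κ * m * (2 * Q / (m ^ 2 * β * b) + 4 * β * Q * T / m ^ 2) +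
          8 * (κ * (Φ * D)) / (m * β) := by
      field_simp
      ring
    rw [h2, h3] at h1
    have h4 : 8 * (κ * (Φ * D)) / (m * β) ≤ Y / 1000 := by
      rw [div_le_iff₀ (by positivity)]
      have h5 := mul_le_mul_of_nonneg_left hΦD hκ0.le
      subst hK
      linarith [mul_nonneg (mul_nonneg hm.le hβ0.le) hY]
    linarith
  have hF' : β ^ 2 * F ≤ β * (Q / b) + 2 * β ^ 3 * Q * T + 84 * (Φ * w) := by
    have h1 := mul_le_mul_of_nonneg_left hF hβ0.le
    have h2 : β * (4 * (Φ * D)) ≤ 84 * (Φ * w) := by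
      have h3 := mul_le_mul_of_nonneg_left hΦD hβ0.le
      have h4 : β * (Φ * w) ≤ Φ * w := mul_le_of_le_one_left (by positivity) hβ1
      linarith
    linarith
  have hR' : κ * R ≤ κ * (2 * (1 - q) / q * (P + Q / b) + 4 / q ^ 2 * (2 * β * (Q / b) +
      4 * β ^ 3 * Q * T + 2 * β ^ 2 * Q * T)) + Y / 1000 := by
    set Z := 2 * β * (Q / b) + 4 * β ^ 3 * Q * T + 2 * β ^ 2 * Q * T with hZ
    have hZ0 : 0 ≤ Z := by positivity
    -- For `Φ w` the count is `2 · 84` from `F` and `4 · 21` from `D`, in all 252; for `L² w` it is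
    -- only 42.
    have h0 : T * (2 * β ^ 2 * Q) + 2 * β ^ 2 * F + (2 * L ^ 2 + 4 * Φ) * D ≤
        Z + 252 * ((L ^ 2 + Φ) * w) := by
      have h1 : 0 ≤ L ^ 2 * w := by positivity
      have h2 := mul_le_mul_of_nonneg_left hD' (sq_nonneg L)
      have h3 : 0 ≤ Φ * w := by positivity
      linarith
    have h1 : 2 * (1 - q) / q *
        (T * (2 * β ^ 2 * Q) + 2 * β ^ 2 * F + (2 * L ^ 2 + 4 * Φ) * D) ≤
        2 / q * (Z + 252 * ((L ^ 2 + Φ) * w)) := by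
      have h2 := mul_le_mul_of_nonneg_left h0
        (show 0 ≤ 2 * (1 - q) / q by have : 0 ≤ 1 - q := by linarith
                                     positivity)
      refine h2.trans ?_
      gcongr
      linarith
    have h2 := mul_le_mul_of_nonneg_left (hR.trans (add_le_add_right h1 _))
      (show 0 ≤ κ * 2 / q by positivity)
    have h3 : κ * 2 / q * (q / 2 * R) = κ * R := by field_simp
    have h4 : κ * 2 / q * ((1 - q) * (P + Q / b) + 2 / q * (Z + 252 * ((L ^ 2 + Φ) * w))) =
        κ * (2 * (1 - q) / q * (P + Q / b) + 4 / q ^ 2 * Z) +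
          1008 * ((L ^ 2 + Φ) * κ * w) / q ^ 2 := by
      field_simp
      ring
    rw [h3, h4] at h2
    have h5 : 1008 * ((L ^ 2 + Φ) * κ * w) / q ^ 2 ≤ Y / 1000 := by
      rw [div_le_iff₀ (by positivity)]
      subst hK
      linarith [mul_nonneg (sq_nonneg q) hY]
    linarith
  have hℓ' : ℓ ≤ 1 / 1000 := by
    refine abs_le_of_sq_le_sq' (a := ℓ) (b := 1 / 1000) ?_ (by norm_num) |>.2
    have h1 : q ^ 6 ≤ 1 := pow_le_one₀ hq0.le hq1
    have h2 : L ^ 2 * κ ^ 2 * u ≤ (L ^ 2 + Φ) * κ ^ 2 * u := by gcongr; linarith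
    rw [hℓ]
    subst hK
    norm_num
    linarith
  have hN' : m * N + Y ≤ m * X + κ * R + κ * (2 * (m * E)) + κ * (2 * (L ^ 2 * C)) + ℓ * Y := by
    have h1 := mul_le_mul_of_nonneg_left hN hm.le
    have h2 : m * (N + Y / m) = m * N + Y := by field_simp
    have h3 : m * (X + κ * (R / m + 2 * E + 2 * L ^ 2 * C / m) + ℓ * (Y / m)) =
        m * X + κ * R + κ * (2 * (m * E)) + κ * (2 * (L ^ 2 * C)) + ℓ * Y := by
      field_simp
      ring
    rwa [h2, h3] at h1
  have hℓY := mul_le_mul_of_nonneg_right hℓ' hY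
  have hκLC := mul_le_mul_of_nonneg_left hLC hκ0.le
  have hfin : 2 * m * (X + κ *
      (2 * (1 - q) / q * ((P + Q / b) / m) + 4 / q ^ 2 * (2 * β * (Q / b) + 4 * β ^ 3 * Q * T +
        2 * β ^ 2 * Q * T) / m + 2 * Q / (m ^ 2 * β * b) + 4 * β * Q * T / m ^ 2)) =
      2 * (m * X + κ * (2 * (1 - q) / q * (P + Q / b) + 4 / q ^ 2 * (2 * β * (Q / b) +
        4 * β ^ 3 * Q * T + 2 * β ^ 2 * Q * T)) +
        κ * m * (2 * Q / (m ^ 2 * β * b) + 4 * β * Q * T / m ^ 2)) := by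
    field_simp
    ring
  rw [hfin]
  -- The surviving source terms become opaque; what remains is linear, with the single `Y` on the
  -- left paying for the fractions of `Y` and for `L² C`.
  generalize κ * (2 * (1 - q) / q * (P + Q / b) + 4 / q ^ 2 * (2 * β * (Q / b) +
    4 * β ^ 3 * Q * T + 2 * β ^ 2 * Q * T)) = a₁ at hR' ⊢
  generalize κ * m * (2 * Q / (m ^ 2 * β * b) + 4 * β * Q * T / m ^ 2) = a₂ at hE' ⊢
  clear hR hE hF hF' hD hC hN hsmall hβ hAβ hΦD
  subst hK
  linarith

/-- The constants of the combined bound are within those of the convergence rate. -/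
theorem combined_bound_le_rate {n T B η β q κ G μ νSq Δ P : ℝ} (hn : 0 < n) (hT : 0 < T)
    (hB : 0 < B) (hη : 0 < η) (hβ : 0 < β) (hq : 0 < q) (hq1 : q ≤ 1) (hμ : 0 < μ) (hG : 0 < G)
    (hκ : κ = G / μ) (hκ1 : 1 ≤ κ) (hν : 0 ≤ νSq) (hΔ : 0 ≤ Δ) (hP : 0 ≤ P) :
    1 / (n * T) * (2 * n * (2 * G * Δ / η + κ *
      (2 * (1 - q) / q * ((P + n * νSq / B) / n) + 4 / q ^ 2 * (2 * β * (n * νSq / B) +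
        4 * β ^ 3 * (n * νSq) * T + 2 * β ^ 2 * (n * νSq) * T) / n +
        2 * (n * νSq) / (n ^ 2 * β * B) + 4 * β * (n * νSq) * T / n ^ 2))) ≤
      8 * G ^ 2 * Δ / (T * η * μ)
        + 76 * νSq * κ ^ 2 / (n * T * β * B)
        + 152 * β * νSq * κ ^ 2 / n
        + 44 * (1 - q) * νSq * κ ^ 2 / (T * B * q)
        + 352 * β ^ 2 * νSq * κ ^ 2 / q ^ 2
        + 352 * β * νSq * κ ^ 2 / (T * B * q ^ 2)
        + 704 * νSq * κ ^ 2 * β ^ 3 / q ^ 2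
        + 44 * (1 - q) * κ ^ 2 / (n * T * q) * P := by
  have hr : 0 ≤ 1 - q := by linarith
  -- The derived bound has only one factor `κ` on the noise and initial-gradient terms; `κ ≥ 1`
  -- raises it to the `κ²` of the rate. The numerical constants of the rate are larger throughout.
  have key : ∀ {z : ℝ}, 0 ≤ z → 0 ≤ κ * z ∧ κ * z ≤ κ ^ 2 * z := fun {z} hz =>
    ⟨by positivity, mul_le_mul_of_nonneg_right (le_self_pow₀ hκ1 two_ne_zero) hz⟩
  have h0 : 0 ≤ G * Δ / (T * η) := by positivity
  have h0' : G * Δ / (T * η) ≤ κ * (G * Δ / (T * η)) := le_mul_of_one_le_left h0 hκ1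
  have h1 := key (show 0 ≤ νSq / (n * T * β * B) by positivity)
  have h2 := key (show 0 ≤ β * νSq / n by positivity)
  have h3 := key (show 0 ≤ (1 - q) * νSq / (T * B * q) by positivity)
  have h4 := key (show 0 ≤ β ^ 2 * νSq / q ^ 2 by positivity)
  have h5 := key (show 0 ≤ β * νSq / (T * B * q ^ 2) by positivity)
  have h6 := key (show 0 ≤ νSq * β ^ 3 / q ^ 2 by positivity)
  have h7 := key (show 0 ≤ (1 - q) * P / (n * T * q) by positivity)
  have hl : 1 / (n * T) * (2 * n * (2 * G * Δ / η + κ *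
      (2 * (1 - q) / q * ((P + n * νSq / B) / n) + 4 / q ^ 2 * (2 * β * (n * νSq / B) +
        4 * β ^ 3 * (n * νSq) * T + 2 * β ^ 2 * (n * νSq) * T) / n +
        2 * (n * νSq) / (n ^ 2 * β * B) + 4 * β * (n * νSq) * T / n ^ 2))) =
      4 * (G * Δ / (T * η)) + (4 * (κ * (νSq / (n * T * β * B))) + 8 * (κ * (β * νSq / n)) +
        4 * (κ * ((1 - q) * νSq / (T * B * q))) + 16 * (κ * (β ^ 2 * νSq / q ^ 2)) +
        16 * (κ * (β * νSq / (T * B * q ^ 2))) + 32 * (κ * (νSq * β ^ 3 / q ^ 2)) +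
        4 * (κ * ((1 - q) * P / (n * T * q)))) := by
    field_simp
    ring
  have hz0 : 8 * G ^ 2 * Δ / (T * η * μ) = 8 * (κ * (G * Δ / (T * η))) := by
    rw [hκ]
    field_simp
  have hz : 76 * νSq * κ ^ 2 / (n * T * β * B) = 76 * (κ ^ 2 * (νSq / (n * T * β * B))) ∧
      152 * β * νSq * κ ^ 2 / n = 152 * (κ ^ 2 * (β * νSq / n)) ∧
      44 * (1 - q) * νSq * κ ^ 2 / (T * B * q) =
        44 * (κ ^ 2 * ((1 - q) * νSq / (T * B * q))) ∧
      352 * β ^ 2 * νSq * κ ^ 2 / q ^ 2 = 352 * (κ ^ 2 * (β ^ 2 * νSq / q ^ 2)) ∧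
      352 * β * νSq * κ ^ 2 / (T * B * q ^ 2) =
        352 * (κ ^ 2 * (β * νSq / (T * B * q ^ 2))) ∧
      704 * νSq * κ ^ 2 * β ^ 3 / q ^ 2 = 704 * (κ ^ 2 * (νSq * β ^ 3 / q ^ 2)) ∧
      44 * (1 - q) * κ ^ 2 / (n * T * q) * P = 44 * (κ ^ 2 * ((1 - q) * P / (n * T * q))) := by
    refine ⟨?_, ?_, ?_, ?_, ?_, ?_, ?_⟩ <;> ring
  obtain ⟨e1, e2, e3, e4, e5, e6, e7⟩ := hz
  rw [hl, hz0, e1, e2, e3, e4, e5, e6, e7]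
  generalize G * Δ / (T * η) = z0 at *
  generalize νSq / (n * T * β * B) = z1 at *
  generalize β * νSq / n = z2 at *
  generalize (1 - q) * νSq / (T * B * q) = z3 at *
  generalize β ^ 2 * νSq / q ^ 2 = z4 at *
  generalize β * νSq / (T * B * q ^ 2) = z5 at *
  generalize νSq * β ^ 3 / q ^ 2 = z6 at *
  generalize (1 - q) * P / (n * T * q) = z7 at *
  linarith [h1.1, h1.2, h2.1, h2.2, h3.1, h3.2, h4.1, h4.2, h5.1, h5.2, h6.1, h6.2, h7.1, h7.2]

/-- What the bounds on the step size and on the momentum parameter give. -/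
theorem stepSize_conditions {n η β q κ L Φ μ : ℝ} (hn : 0 < n) (hμ : 0 < μ) (hκ : 0 ≤ κ)
    (hη : 0 < η) (hΦ : 0 ≤ Φ)
    (hη_lt : η < μ * q ^ 3 / (κ * √(1632000 * (L ^ 2 + Φ))))
    (hβ_ge : 1632000 * (L ^ 2 + Φ) * κ ^ 2 * η ^ 2 / (n * μ ^ 2 * q ^ 6) ≤ β) :
    0 < κ ∧ 0 < q ∧ 0 < β ∧
      1632000 * ((L ^ 2 + Φ) * κ ^ 2 * (η ^ 2 / μ ^ 2)) ≤ q ^ 6 ∧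
      1632000 * ((L ^ 2 + Φ) * κ ^ 2 * (η ^ 2 / μ ^ 2)) ≤ n * β * q ^ 6 := by
  have hA : 0 ≤ 1632000 * (L ^ 2 + Φ) := by positivity
  have hden : 0 < κ * √(1632000 * (L ^ 2 + Φ)) := by
    -- Division by zero gives zero, and then the step size bound would contradict `η > 0`. So the
    -- bound itself forces `κ` and `L² + Φ²` to be positive.
    refine lt_of_le_of_ne (by positivity) fun h => ?_
    rw [← h, div_zero] at hη_lt
    linarith
  have hκ0 : 0 < κ := pos_of_mul_pos_left hden (Real.sqrt_nonneg _)
  have hA0 : 0 < 1632000 * (L ^ 2 + Φ) := Real.sqrt_pos.1 (pos_of_mul_pos_right hden hκ)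
  have h1 := (lt_div_iff₀ hden).1 hη_lt
  -- The step size bound also forces `q³ > 0`, and the cube is odd: `ρ < 1` is a consequence, not an
  -- assumption.
  have hq : 0 < q := by
    have h2 : 0 < q ^ 3 := pos_of_mul_pos_right ((mul_pos hη hden).trans h1) hμ.le
    by_contra h
    linarith [Odd.pow_nonpos (n := 3) (by decide) (not_lt.1 h)]
  have hβ : 0 < β := lt_of_lt_of_le (by positivity) hβ_ge
  refine ⟨hκ0, hq, hβ, ?_, ?_⟩
  · have h2 := pow_le_pow_left₀ (by positivity) h1.le 2
    rw [mul_pow, mul_pow, Real.sq_sqrt hA] at h2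
    calc _ = η ^ 2 * (κ ^ 2 * (1632000 * (L ^ 2 + Φ))) / μ ^ 2 := by ring
      _ ≤ (μ * q ^ 3) ^ 2 / μ ^ 2 := by gcongr
      _ = q ^ 6 := by field_simp
  · rw [div_le_iff₀ (by positivity)] at hβ_ge
    calc _ = 1632000 * (L ^ 2 + Φ) * κ ^ 2 * η ^ 2 / μ ^ 2 := by ring
      _ ≤ β * (n * μ ^ 2 * q ^ 6) / μ ^ 2 := by gcongr
      _ = n * β * q ^ 6 := by field_simp

end MDNPG

end

/-! ### Assembly -/

theorem theorem1 {n d : ℕ} (hn : 0 < n) {S : Fin n → Type*} {A : Type*}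
    [∀ i, Fintype (S i)] [Fintype A]
    (𝓜 : MDNPG.Model n d S A) (I : MDNPG.Input n d) (hT : 0 < I.T) (hB : 0 < I.B)
    (G M Wv μF : ℝ) (ν : Fin n → ℝ)
    (hmix : MDNPG.IsMixing I.𝒢 I.W)
    (hV : BddAbove (Set.range 𝓜.value))
    (hlog : 𝓜.LogPolicyBounded G M)
    (himp : 𝓜.ImpWeightVarBounded Wv)
    (hvar : 𝓜.GradEstVarBounded ν)
    (hμF : 0 < μF) (hfisher : 𝓜.FisherLowerBound μF)
    (ρ κF L ΦSq νSq Δ : ℝ)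
    (hρ : ρ = MDNPG.mixRate I.W)
    (hκF : κF = G / μF)
    (hL : L = 𝓜.constL G M)
    (hΦ : ΦSq = 𝓜.constΦSq G M Wv)
    (hνSq : νSq = (1 / (n : ℝ)) * ∑ i, ν i ^ 2)
    (hΔ : Δ = (⨆ θ, 𝓜.value θ) - 𝓜.value I.θ₀)
    (hη_pos : 0 < I.η)
    (hη_lt : I.η < μF * (1 - ρ ^ 2) ^ 3 / (κF * √(1632000 * (L ^ 2 + ΦSq))))
    (hβ_ge : 1632000 * (L ^ 2 + ΦSq) * κF ^ 2 * I.η ^ 2 / (n * μF ^ 2 * (1 - ρ ^ 2) ^ 6) ≤ I.β)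
    (hβ_lt : I.β < 1 / (n : ℝ)) :
    MDNPG.expOut 𝓜 I (fun θ => ‖gradient 𝓜.value θ‖ ^ 2) ≤
      8 * G ^ 2 * Δ / (I.T * I.η * μF)
        + 76 * νSq * κF ^ 2 / (n * I.T * I.β * I.B)
        + 152 * I.β * νSq * κF ^ 2 / n
        + 44 * ρ ^ 2 * νSq * κF ^ 2 / (I.T * I.B * (1 - ρ ^ 2))
        + 352 * I.β ^ 2 * νSq * κF ^ 2 / (1 - ρ ^ 2) ^ 2
        + 352 * I.β * νSq * κF ^ 2 / (I.T * I.B * (1 - ρ ^ 2) ^ 2)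
        + 704 * νSq * κF ^ 2 * I.β ^ 3 / (1 - ρ ^ 2) ^ 2
        + 44 * ρ ^ 2 * κF ^ 2 / (n * I.T * (1 - ρ ^ 2))
            * ∑ i, ‖gradient (𝓜.localValue i) I.θ₀‖ ^ 2 := by
  have hn' : (0 : ℝ) < n := Nat.cast_pos.2 hn
  have hT' : (0 : ℝ) < I.T := Nat.cast_pos.2 hT
  have hB' : (0 : ℝ) < I.B := Nat.cast_pos.2 hB
  have hG0 := hlog.G_nonneg ⟨0, hn⟩
  have hΦ0 : 0 ≤ ΦSq := hΦ ▸ hlog.constΦSq_nonneg himp hn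
  obtain ⟨hκ0, hq, hβ0, hsmall, hβsmall⟩ := MDNPG.stepSize_conditions (q := 1 - ρ ^ 2) hn' hμF
    (hκF ▸ div_nonneg hG0 hμF.le) hη_pos hΦ0 hη_lt hβ_ge
  have hG : 0 < G := by
    rw [hκF] at hκ0
    exact (div_pos_iff_of_pos_right hμF).1 hκ0
  have hq1 : 1 - ρ ^ 2 ≤ 1 := by linarith [sq_nonneg ρ]
  have hβ1 : I.β ≤ 1 := by
    have h1 : (1 : ℝ) ≤ n := Nat.one_le_cast.2 hn
    have h2 : 1 / (n : ℝ) ≤ 1 := by rw [div_le_one hn']; exact h1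
    linarith
  have hΔ0 : 0 ≤ Δ := by
    rw [hΔ, sub_nonneg]
    exact le_ciSup hV I.θ₀
  have hν0 : 0 ≤ νSq := by rw [hνSq]; positivity
  have hQ : ∑ i, ν i ^ 2 = n * νSq := by rw [hνSq]; field_simp
  -- For `d = 0` the inequality `κ_F ≥ 1` may fail, but every gradient is zero and the right side is
  -- nonnegative.
  rcases Nat.eq_zero_or_pos d with hd | hd
  · subst hd
    have h0 : MDNPG.expOut 𝓜 I (fun θ => ‖gradient 𝓜.value θ‖ ^ 2) = 0 := by
      rw [MDNPG.expOut]
      refine Finset.sum_eq_zero fun o _ => ?_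
      rw [Subsingleton.elim (gradient 𝓜.value _) 0]
      simp
    rw [h0]
    positivity
  have hκ1 : 1 ≤ κF := by
    rw [hκF, one_le_div hμF]
    exact hfisher.le_of_pos hlog ⟨0, hn⟩ hd
  have hρ1 : MDNPG.mixRate I.W ^ 2 < 1 := by rw [← hρ]; linarith
  have hC := MDNPG.runSum_dev_θ_le (𝓜 := 𝓜) hn hmix hρ1 hμF hfisher
  have hD := MDNPG.runSum_moveSq_le (𝓜 := 𝓜) hn hmix hρ1 hμF hfisher
  have hE := MDNPG.runSum_avg_gradErr_le hn hmix hlog himp hvar hβ0.le hβ1 hB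
  have hF := MDNPG.runSum_sum_gradErr_le hn hmix hlog himp hvar hβ0.le hβ1 hB
  have hR := MDNPG.runSum_dev_y_le hn hmix hlog himp hvar hβ0.le hβ1 hB hρ1
  have hN := MDNPG.runSum_descent hn hmix hlog hV hμF hfisher hG hη_pos
  have htotal := MDNPG.runSum_gradient_le (I := I) hn hmix hlog
  rw [← hρ] at hC hD hR
  rw [← hL] at hR hN htotal
  rw [← hΦ] at hE hF hR
  rw [← hΔ] at hN
  rw [hQ] at hE hF hR
  have hρq : ρ ^ 2 = 1 - (1 - ρ ^ 2) := by ring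
  set q := 1 - ρ ^ 2 with hq_def
  rw [hρq] at hC hR ⊢
  have hY : 0 ≤ MDNPG.runSum 𝓜 I fun s => ∑ i, ‖s.y i‖ ^ 2 :=
    MDNPG.runSum_nonneg fun s => by positivity
  have hN' : MDNPG.runSum 𝓜 I (fun s => ‖gradient 𝓜.value (MDNPG.avg s.θ)‖ ^ 2) +
      MDNPG.runSum 𝓜 I (fun s => ∑ i, ‖s.y i‖ ^ 2) / n ≤ 2 * G * Δ / I.η +
      κF * (MDNPG.runSum 𝓜 I (fun s => MDNPG.dev s.y) / n +
        2 * MDNPG.runSum 𝓜 I (fun s => ‖MDNPG.avg (MDNPG.gradErr 𝓜 s)‖ ^ 2) +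
        2 * L ^ 2 * MDNPG.runSum 𝓜 I (fun s => MDNPG.dev s.θ) / n) +
      κF * L * I.η / μF * (MDNPG.runSum 𝓜 I (fun s => ∑ i, ‖s.y i‖ ^ 2) / n) := by
    -- Normalizing the coefficient of the squared gradient to one turns `η / (2 μF)` into `κ_F` and
    -- the second-order coefficient into `κ_F L η / μF`, the small `ℓ` of the combination.
    have h1 := mul_le_mul_of_nonneg_left hN (show 0 ≤ 2 * G / I.η by positivity)
    refine le_trans (le_of_eq ?_) (h1.trans (le_of_eq ?_))
    · field_simp
    · rw [hκF]
      field_simp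
  have hbound := MDNPG.combine_error_bounds hn' hT'.le hβ0 hβ1 hq hq1 hκ1 hΦ0
    (show 0 ≤ I.η ^ 2 / μF ^ 2 by positivity) hY (show 0 ≤ n * νSq by positivity)
    hB' rfl hsmall hβsmall (by ring) hC hD hE hF hR hN'
  have htotal0 : 0 ≤ MDNPG.runSum 𝓜 I fun s => ∑ i, ‖gradient 𝓜.value (s.θ i)‖ ^ 2 :=
    MDNPG.runSum_nonneg fun s => by positivity
  refine le_trans ?_ (MDNPG.combined_bound_le_rate hn' hT' hB' hη_pos hβ0 hq hq1 hμF hG hκF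
    hκ1 hν0 hΔ0 (Finset.sum_nonneg fun i _ => sq_nonneg ‖gradient (𝓜.localValue i) I.θ₀‖))
  rw [MDNPG.expOut_eq]
  -- The output is uniform over `T + 1` rounds, whereas the rate is stated with `T`.
  calc _ ≤ 1 / ((n : ℝ) * I.T) *
        MDNPG.runSum 𝓜 I (fun s => ∑ i, ‖gradient 𝓜.value (s.θ i)‖ ^ 2) := by
        refine mul_le_mul_of_nonneg_right ?_ htotal0
        gcongr
        linarith
    _ ≤ _ := mul_le_mul_of_nonneg_left (htotal.trans hbound) (by positivity)
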